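/- Let $F$ be a field of characteristic zero, $q \ge 1$ an integer and $t = 2^q$. Let $L = P(t)$ be the Lie superalgebra of all $2t \times 2t$ matrices $\begin{pmatrix} A & B \\ C & -A^T \end{pmatrix}$ over $F$, with $t\times t$ blocks satisfying $\operatorname{tr} A = 0$, $B^T = B$, $C^T = -C$; its even part consists of the matrices with $B = C = 0$, its odd part of those with $A = 0$, and its product is the supercommutator $[x,y] = xy - (-1)^{|x||y|} yx$. Let $G_0 = \langle a_1\rangle \times \langle b_1 \rangle \times \cdots \times \langle a_q\rangle \times \langle b_q\rangle$ and $G = \langle a_0 \rangle \times G_0 \cong (\mathbb{Z}_2)^{2q+1}$, where all the generators have order $2$. Put $$\sigma_0 = \begin{pmatrix} 1 & 0 \\ 0 & 1\end{pmatrix},\quad \sigma_1 = \begin{pmatrix} 1 & 0 \\ 0 & -1\end{pmatrix},\quad \sigma_2 = \begin{pmatrix} 0 & 1 \\ 1 & 0\end{pmatrix},\quad \sigma_3 = \begin{pmatrix} 0 & 1 \\ -1 & 0\end{pmatrix},$$ and for $g = g_1 \cdots g_q \in G_0$ with $g_i \in \langle a_i \rangle\times\langle b_i\rangle$ let $R_g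 \subseteq M_t(F)$ be the line spanned by the Kronecker product $x_1 \otimes \cdots \otimes x_q$, where $x_i = \sigma_0, \sigma_1, \sigma_2, \sigma_3$ according as $g_i = e, a_i, b_i, a_i b_i$. The Pauli grading $L = \bigoplus_{h \in G} L_h$ is given, for $g \in G_0$, by: $L_g$ consists of the matrices $\begin{pmatrix} X & 0 \\ 0 & -X^T\end{pmatrix}$ with $X \in R_g$, $\operatorname{tr} X = 0$; and $L_{a_0 g}$ is spanned by the matrices $\begin{pmatrix} 0 & X \\ 0 & 0\end{pmatrix}$ with $X \in R_g$, $X^T = X$, and the matrices $\begin{pmatrix} 0 & 0 \\ X & 0\end{pmatrix}$ with $X \in R_g$, $X^T = -X$. For $G = \{g_1, \dots, g_k\}$, $k = |G|$, let $F\{X\}$ be the absolutely free (nonassociative, non-unital) algebra on $X = \bigcup_{g\in G} X_g$ with every $X_g$ countably infinite, let $P_{n_1,\dots,n_k}$ be its subspace of polynomials multilinear in $n_i$ fixed variables of $X_{g_i}$, $1 \le i \le k$, and let $Id^G(L)$ be the set of graded identities of $L$, that is, of the polynomials that vanish whenever the variables of each $X_g$ are replaced by elements of $L_g$. Let $$c_n^G(L)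 = \sum_{n_1 + \cdots + n_k = n} \binom{n}{n_1,\dots,n_k} \dim \frac{P_{n_1,\dots,n_k}}{P_{n_1,\dots,n_k} \cap Id^G(L)}$$ be the $n$-th graded codimension of $L$. Then the graded PI-exponent $exp^G(L) = \lim_{n\to\infty} \sqrt[n]{c_n^G(L)}$ exists and $$exp^G(L) = t^2 - 1 + t\sqrt{t^2 - 1}.$$ -/

import Mathlib

open Matrix Filter Topology

noncomputable section

/-! ### Graded identities and graded codimensions of nonassociative algebras -/

/-- The number of occurrences of the variable `x` in a nonassociative monomial. -/
def occurrences {V : Type*} [DecidableEq V] (x : V) : FreeMagma V → ℕ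
  | .of y => if y = x then 1 else 0
  | .mul u v => occurrences x u + occurrences x v

/-- The absolutely free (nonassociative, non-unital) algebra `F{X}` on the graded set of variables
`X = ⋃ g, X_g`; the variable `(g, i)` is the `i`-th element of `X_g`, `i = 0, 1, 2, …`. -/
abbrev FreeGradedAlgebra (F : Type*) [Field F] (G : Type*) : Type _ :=
  FreeNonUnitalNonAssocAlgebra F (G × ℕ)

/-- The monomials that are multilinear in the variables `(g, i)`, `i < n g`: each of these
variables occurs exactly once, and no other variable occurs. -/
def IsMultilinearMonomial {G : Type*} [DecidableEq G] (n : G → ℕ) (m : FreeMagma (G × ℕ)) : Prop :=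
  ∀ x : G × ℕ, occurrences x m = if x.2 < n x.1 then 1 else 0

/-- The space `P_n`, `n = (n_g)`, of multilinear polynomials in `n_g` fixed variables of each
degree `g`. -/
def multilinearPolynomials (F : Type*) [Field F] {G : Type*} [DecidableEq G] (n : G → ℕ) :
    Submodule F (FreeGradedAlgebra F G) :=
  Submodule.span F
    {f | ∃ m : FreeMagma (G × ℕ), IsMultilinearMonomial n m ∧ f = MonoidAlgebra.ofMagma F _ m}

section Codimensions

variable (F : Type*) [Field F] {G : Type*} {A : Type*} [NonUnitalNonAssocRing A] [Module F A]
  [IsScalarTower F A A] [SMulCommClass F A A]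

/-- The graded identities of `A = ⨁ g, A_g`: the polynomials which vanish under every
substitution of the variables of degree `g` by elements of `A_g`. -/
def gradedIdentities (𝒜 : G → Submodule F A) : Submodule F (FreeGradedAlgebra F G) where
  carrier := {f | ∀ φ : G × ℕ → A, (∀ x, φ x ∈ 𝒜 x.1) →
    FreeNonUnitalNonAssocAlgebra.lift F φ f = 0}
  add_mem' := by
    intro f g hf hg φ hφ
    rw [map_add, hf φ hφ, hg φ hφ, add_zero]
  zero_mem' := by
    intro φ _
    exact map_zero _
  smul_mem' := by
    intro c f hf φ hφ
    rw [map_smul, hf φ hφ, smul_zero]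

/-- The partial codimension `dim (P_n / (P_n ∩ Id^G(A)))`. -/
def partialCodimension [DecidableEq G] (𝒜 : G → Submodule F A) (n : G → ℕ) : ℕ :=
  Module.finrank F
    (multilinearPolynomials F n ⧸
      (gradedIdentities F 𝒜).comap (multilinearPolynomials F n).subtype)

/-- The graded codimension `c_N^G(A)`: the sum over all `n : G → ℕ` of total degree `N` of the
multinomial coefficient of `n` times the partial codimension. -/
def gradedCodimension [Fintype G] [DecidableEq G] (𝒜 : G → Submodule F A) (N : ℕ) : ℕ :=
  ∑ n ∈ Finset.piAntidiag (Finset.univ : Finset G) N,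
    Nat.multinomial Finset.univ n * partialCodimension F 𝒜 n

end Codimensions

/-! ### The Lie superalgebra `P(t)` -/

section LieSuperalgebraP

section Parts

variable {F : Type*} [Field F] {ι : Type*}

/-- The even part of a matrix of `M_{t,t}(F)`. -/
def evenPart (X : Matrix (ι ⊕ ι) (ι ⊕ ι) F) : Matrix (ι ⊕ ι) (ι ⊕ ι) F :=
  fromBlocks X.toBlocks₁₁ 0 0 X.toBlocks₂₂

/-- The odd part of a matrix of `M_{t,t}(F)`. -/
def oddPart (X : Matrix (ι ⊕ ι) (ι ⊕ ι) F) : Matrix (ι ⊕ ι) (ι ⊕ ι) F :=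
  fromBlocks 0 X.toBlocks₁₂ X.toBlocks₂₁ 0

theorem evenPart_add (X Y : Matrix (ι ⊕ ι) (ι ⊕ ι) F) :
    evenPart (X + Y) = evenPart X + evenPart Y := by
  ext (i | i) (j | j) <;> simp [evenPart, toBlocks₁₁, toBlocks₂₂]

theorem oddPart_add (X Y : Matrix (ι ⊕ ι) (ι ⊕ ι) F) :
    oddPart (X + Y) = oddPart X + oddPart Y := by
  ext (i | i) (j | j) <;> simp [oddPart, toBlocks₁₂, toBlocks₂₁]

theorem evenPart_smul (c : F) (X : Matrix (ι ⊕ ι) (ι ⊕ ι) F) :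
    evenPart (c • X) = c • evenPart X := by
  ext (i | i) (j | j) <;> simp [evenPart, toBlocks₁₁, toBlocks₂₂]

theorem oddPart_smul (c : F) (X : Matrix (ι ⊕ ι) (ι ⊕ ι) F) :
    oddPart (c • X) = c • oddPart X := by
  ext (i | i) (j | j) <;> simp [oddPart, toBlocks₁₂, toBlocks₂₁]

end Parts

variable (F : Type*) [Field F] (ι : Type*) [Fintype ι]

variable {F ι} in
/-- The supercommutator of `M_{t,t}(F)`: the bilinear extension of
`[x, y] = x y - (-1)^{|x||y|} y x`. -/
def superBracket (X Y : Matrix (ι ⊕ ι) (ι ⊕ ι) F) : Matrix (ι ⊕ ι) (ι ⊕ ι) F :=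
  (evenPart X * evenPart Y - evenPart Y * evenPart X) +
  (evenPart X * oddPart Y - oddPart Y * evenPart X) +
  (oddPart X * evenPart Y - evenPart Y * oddPart X) +
  (oddPart X * oddPart Y + oddPart Y * oddPart X)

/-- The subspace of the block matrices `(A, B; C, -Aᵀ)` with `tr A = 0`, `Bᵀ = B`, `Cᵀ = -C`;
here `t` is the cardinality of `ι`. -/
def superPSubmodule : Submodule F (Matrix (ι ⊕ ι) (ι ⊕ ι) F) where
  carrier := {X | ∃ A B C : Matrix ι ι F, A.trace = 0 ∧ Bᵀ = B ∧ Cᵀ = -C ∧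
    X = fromBlocks A B C (-Aᵀ)}
  add_mem' := by
    rintro _ _ ⟨A, B, C, hA, hB, hC, rfl⟩ ⟨A', B', C', hA', hB', hC', rfl⟩
    refine ⟨A + A', B + B', C + C', ?_, ?_, ?_, ?_⟩
    · rw [trace_add, hA, hA', add_zero]
    · rw [transpose_add, hB, hB']
    · rw [transpose_add, hC, hC', neg_add]
    · rw [fromBlocks_add, transpose_add, neg_add]
  zero_mem' := ⟨0, 0, 0, by simp, by simp, by simp, by simp⟩
  smul_mem' := by
    rintro c _ ⟨A, B, C, hA, hB, hC, rfl⟩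
    refine ⟨c • A, c • B, c • C, ?_, ?_, ?_, ?_⟩
    · rw [trace_smul, hA, smul_zero]
    · rw [transpose_smul, hB]
    · rw [transpose_smul, hC, smul_neg]
    · rw [fromBlocks_smul, transpose_smul, smul_neg]

/-- The Lie superalgebra `P(t)`, where `t` is the cardinality of `ι`. -/
abbrev SuperP : Type _ := ↥(superPSubmodule F ι)

variable {F ι}

theorem superBracket_fromBlocks (A B C D A' B' C' D' : Matrix ι ι F) :
    superBracket (fromBlocks A B C D) (fromBlocks A' B' C' D') =
      fromBlocks (A * A' - A' * A + (B * C' + B' * C)) (A * B' - B' * D + (B * D' - A' * B))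
        (D * C' - C' * A + (C * A' - D' * C)) (D * D' - D' * D + (C * B' + C' * B)) := by
  simp only [superBracket, evenPart, oddPart, toBlocks_fromBlocks₁₁, toBlocks_fromBlocks₁₂,
    toBlocks_fromBlocks₂₁, toBlocks_fromBlocks₂₂, fromBlocks_multiply, sub_eq_add_neg,
    fromBlocks_neg, fromBlocks_add]
  simp

theorem superBracket_mem [CharZero F] {X Y : Matrix (ι ⊕ ι) (ι ⊕ ι) F}
    (hX : X ∈ superPSubmodule F ι) (hY : Y ∈ superPSubmodule F ι) :
    superBracket X Y ∈ superPSubmodule F ι := by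
  obtain ⟨A, B, C, hA, hB, hC, rfl⟩ := hX
  obtain ⟨A', B', C', hA', hB', hC', rfl⟩ := hY
  have key : ∀ S K : Matrix ι ι F, Sᵀ = S → Kᵀ = -K → (S * K).trace = 0 := by
    intro S K hS hK
    have h : (S * K).trace = -(S * K).trace := by
      conv_lhs =>
        rw [← trace_transpose, transpose_mul, hS, hK, neg_mul, trace_neg, trace_mul_comm]
    exact self_eq_neg.mp h
  rw [superBracket_fromBlocks]
  refine ⟨_, _, _, ?_, ?_, ?_, congrArg _ ?_⟩
  · rw [trace_add, trace_add, trace_sub, trace_mul_comm A A', sub_self, key B C' hB hC',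
      key B' C hB' hC, add_zero, add_zero]
  · simp only [transpose_add, transpose_sub, transpose_mul, transpose_neg, transpose_transpose,
      hB, hB', mul_neg, sub_neg_eq_add]
    abel
  · simp only [transpose_add, transpose_sub, transpose_mul, transpose_neg, transpose_transpose,
      hC, hC', mul_neg, neg_mul, sub_neg_eq_add]
    abel
  · simp only [transpose_add, transpose_sub, transpose_mul, hB, hB', hC, hC', mul_neg, neg_mul]
    abel

/-- The product of `P(t)` is the supercommutator. -/
instance instMulSuperP [CharZero F] : Mul (SuperP F ι) where
  mul X Y := ⟨superBracket X.1 Y.1, superBracket_mem X.2 Y.2⟩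

theorem SuperP.coe_mul [CharZero F] (X Y : SuperP F ι) :
    ((X * Y : SuperP F ι) : Matrix (ι ⊕ ι) (ι ⊕ ι) F) = superBracket X.1 Y.1 := rfl

theorem superBracket_add (X Y Z : Matrix (ι ⊕ ι) (ι ⊕ ι) F) :
    superBracket X (Y + Z) = superBracket X Y + superBracket X Z := by
  simp only [superBracket, evenPart_add, oddPart_add, mul_add, add_mul]
  abel

theorem add_superBracket (X Y Z : Matrix (ι ⊕ ι) (ι ⊕ ι) F) :
    superBracket (X + Y) Z = superBracket X Z + superBracket Y Z := by
  simp only [superBracket, evenPart_add, oddPart_add, mul_add, add_mul]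
  abel

theorem superBracket_smul (c : F) (X Y : Matrix (ι ⊕ ι) (ι ⊕ ι) F) :
    superBracket X (c • Y) = c • superBracket X Y := by
  simp only [superBracket, evenPart_smul, oddPart_smul, mul_smul_comm, smul_mul_assoc, smul_add,
    smul_sub]

theorem smul_superBracket (c : F) (X Y : Matrix (ι ⊕ ι) (ι ⊕ ι) F) :
    superBracket (c • X) Y = c • superBracket X Y := by
  simp only [superBracket, evenPart_smul, oddPart_smul, mul_smul_comm, smul_mul_assoc, smul_add,
    smul_sub]

instance instNonUnitalNonAssocRingSuperP [CharZero F] : NonUnitalNonAssocRing (SuperP F ι) where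
  left_distrib X Y Z := Subtype.ext (superBracket_add X.1 Y.1 Z.1)
  right_distrib X Y Z := Subtype.ext (add_superBracket X.1 Y.1 Z.1)
  zero_mul X := Subtype.ext (by
    have h := smul_superBracket (0 : F) (0 : Matrix (ι ⊕ ι) (ι ⊕ ι) F) X.1
    rw [zero_smul, zero_smul] at h
    exact h)
  mul_zero X := Subtype.ext (by
    have h := superBracket_smul (0 : F) X.1 (0 : Matrix (ι ⊕ ι) (ι ⊕ ι) F)
    rw [zero_smul, zero_smul] at h
    exact h)

instance instIsScalarTowerSuperP [CharZero F] : IsScalarTower F (SuperP F ι) (SuperP F ι) where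
  smul_assoc c X Y := Subtype.ext (smul_superBracket c X.1 Y.1)

instance instSMulCommClassSuperP [CharZero F] : SMulCommClass F (SuperP F ι) (SuperP F ι) where
  smul_comm c X Y := Subtype.ext (superBracket_smul c X.1 Y.1).symm

end LieSuperalgebraP

/-! ### The Pauli grading -/

section Pauli

/-- The group `G₀ = ⟨a₁⟩ × ⟨b₁⟩ × ⋯ × ⟨a_q⟩ × ⟨b_q⟩ ≅ (ℤ/2)^{2q}`, written additively. -/
abbrev PauliGroupZero (q : ℕ) : Type := Fin q → ZMod 2 × ZMod 2

/-- The group `G = ⟨a₀⟩ × G₀ ≅ (ℤ/2)^{2q+1}`, written additively. -/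
abbrev PauliGroup (q : ℕ) : Type := ZMod 2 × PauliGroupZero q

variable (F : Type*) [Field F]

/-- The matrices `σ₀, σ₁, σ₂, σ₃`, of degrees `e, a, b, ab`, where `a = (1, 0)`, `b = (0, 1)`. -/
def pauliMatrix (u : ZMod 2 × ZMod 2) : Matrix (Fin 2) (Fin 2) F :=
  if u.1 = 0 then (if u.2 = 0 then !![1, 0; 0, 1] else !![0, 1; 1, 0])
  else (if u.2 = 0 then !![1, 0; 0, -1] else !![0, 1; -1, 0])

/-- The Kronecker product `x₁ ⊗ ⋯ ⊗ x_q` of Pauli matrices of degrees `g₁, …, g_q`, a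
`2^q × 2^q` matrix, with rows and columns indexed by `Fin q → Fin 2`. -/
def pauliTensor {q : ℕ} (g : PauliGroupZero q) : Matrix (Fin q → Fin 2) (Fin q → Fin 2) F :=
  Matrix.of fun i j => ∏ k, pauliMatrix F (g k) (i k) (j k)

/-- The homogeneous component `R_g` of `R = M_{2^q}(F)`. -/
def pauliMatrixComponent {q : ℕ} (g : PauliGroupZero q) :
    Submodule F (Matrix (Fin q → Fin 2) (Fin q → Fin 2) F) :=
  Submodule.span F {pauliTensor F g}

/-- The homogeneous components of the Pauli grading of `P(2^q)`. In degree `g ∈ G₀`: the matrices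
`(X, 0; 0, -Xᵀ)` with `X ∈ R_g`, `tr X = 0`. In degree `a₀ g`: the span of the matrices
`(0, X; 0, 0)` with `X ∈ R_g` symmetric, and `(0, 0; X, 0)` with `X ∈ R_g` skew. -/
def pauliGrading (q : ℕ) (g : PauliGroup q) : Submodule F (SuperP F (Fin q → Fin 2)) :=
  if g.1 = 0 then
    Submodule.span F {Y | ∃ X ∈ pauliMatrixComponent F g.2, X.trace = 0 ∧
      Y.val = fromBlocks X 0 0 (-Xᵀ)}
  else
    Submodule.span F {Y | ∃ X ∈ pauliMatrixComponent F g.2,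
      (Xᵀ = X ∧ Y.val = fromBlocks 0 X 0 0) ∨
      (Xᵀ = -X ∧ Y.val = fromBlocks 0 0 X 0)}

end Pauli

end

/-! Every homogeneous component of L is spanned by a single element E g (`pauliGrading_eq_span`),
with E 0 = 0 because the identity matrix has nonzero trace. All monomials of a multilinear type n =
(n_g) therefore take values in one line, and the partial codimension of n is 0 or 1; it is 1 exactly
when some monomial is nonzero at the elements E g.

The algebra also has a grading by -1, 0, 1 (upper odd block 1, lower odd block -1), so a nonzero
type has n_0 = 0 and total weight -1, 0 or 1. Conversely, a type of weight 0 with n_0 = 0 becomes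
nonzero after a fixed number K of variables is added (`exists_add_partialCodimension_ne_zero`): odd
variables are paired, symmetric with skew, into even elements of nonzero degree, and even elements
are absorbed two at a time by multiplying an element whose Pauli tensor anticommutes with theirs.

Up to polynomial factors and the shift by K, the codimension is thus the coefficient of X^N in (c +
a X + b X^2)^N, where a = t^2 - 1, b = t(t+1)/2 and c = t(t-1)/2 count the nonzero components of
weight 0, 1 and -1. This coefficient grows like (a + 2√(bc))^N, and 4bc = t^2(t^2 - 1). The upper
bound is `gradedCodimension_le_pow` at the minimizer w = √(c/b) of a + bw + c/w; the lower bound is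
`pow_le_sum_multinomial_balancedTypes`. -/

/-! ### Multilinear monomials and one-dimensional gradings -/

/-- The multiset of the variables of a nonassociative monomial. -/
def monomialContent {V : Type*} : FreeMagma V → Multiset V
  | .of x => {x}
  | .mul u v => monomialContent u + monomialContent v

theorem monomialContent_mul {V : Type*} (u v : FreeMagma V) :
    monomialContent (u * v) = monomialContent u + monomialContent v := rfl

theorem count_monomialContent {V : Type*} [DecidableEq V] (x : V) (m : FreeMagma V) :
    (monomialContent m).count x = occurrences x m := by
  induction m with
  | ih1 y => simp [monomialContent, occurrences, Multiset.count_singleton, eq_comm]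
  | ih2 u v hu hv =>
    rw [monomialContent_mul, Multiset.count_add, hu, hv]
    rfl

/-- The variables `(g, i)`, `i < n g`. -/
def standardVariables {G : Type*} [Fintype G] (n : G → ℕ) : Multiset (G × ℕ) :=
  ∑ g, (Multiset.range (n g)).map (Prod.mk g)

theorem count_standardVariables {G : Type*} [Fintype G] [DecidableEq G] (n : G → ℕ) (x : G × ℕ) :
    (standardVariables n).count x = if x.2 < n x.1 then 1 else 0 := by
  obtain ⟨g, i⟩ := x
  rw [standardVariables, Multiset.count_sum', Finset.sum_eq_single g]
  · rw [Multiset.count_map_eq_count' _ _ (Prod.mk_right_injective g)]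
    rw [Multiset.count_eq_of_nodup (Multiset.nodup_range _)]
    simp
  · intro h _ hh
    rw [Multiset.count_eq_zero]
    simp [hh]
  · simp

theorem isMultilinearMonomial_iff {G : Type*} [Fintype G] [DecidableEq G] (n : G → ℕ)
    (m : FreeMagma (G × ℕ)) :
    IsMultilinearMonomial n m ↔ monomialContent m = standardVariables n := by
  simp only [IsMultilinearMonomial, Multiset.ext, count_monomialContent, count_standardVariables]

theorem sum_map_standardVariables {G M : Type*} [Fintype G] [AddCommMonoid M] (n : G → ℕ)
    (f : G → M) : ((standardVariables n).map (fun x => f x.1)).sum = ∑ g, n g • f g := by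
  rw [standardVariables, ← Multiset.coe_mapAddMonoidHom, map_sum, Multiset.sum_sum]
  simp

/-- The shift renames the variables of a second factor past those of a first one, so that a product
of multilinear monomials stays multilinear. -/
theorem occurrences_map_shift {G : Type*} [DecidableEq G] (k : G → ℕ) (m : FreeMagma (G × ℕ))
    (x : G × ℕ) :
    occurrences x (FreeMagma.map (fun y : G × ℕ => (y.1, y.2 + k y.1)) m) =
      if k x.1 ≤ x.2 then occurrences (x.1, x.2 - k x.1) m else 0 := by
  induction m with
  | ih1 y =>
    obtain ⟨g, i⟩ := x
    obtain ⟨h, j⟩ := y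
    simp only [FreeMagma.map_of, occurrences, Prod.mk.injEq]
    by_cases hg : h = g
    · subst hg
      simp only [true_and]
      split_ifs <;> omega
    · simp [hg]
  | ih2 u v hu hv =>
    have key : ∀ (y : G × ℕ) (a b : FreeMagma (G × ℕ)),
      occurrences y (a * b) = occurrences y a + occurrences y b := fun _ _ _ => rfl
    rw [map_mul, key, key, hu, hv]
    split_ifs <;> rfl

theorem lift_ofMagma (F : Type*) [Field F] {V A : Type*} [NonUnitalNonAssocRing A] [Module F A]
    [IsScalarTower F A A] [SMulCommClass F A A] (φ : V → A) (m : FreeMagma V) :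
    FreeNonUnitalNonAssocAlgebra.lift F φ (MonoidAlgebra.ofMagma F _ m) =
      FreeMagma.lift φ m := by
  simp [FreeNonUnitalNonAssocAlgebra.lift]

/-- Some multilinear monomial in `n g` variables of each degree `g` takes at the elements `E g` a
nonzero value proportional to `E h`. -/
def IsRealized (F : Type*) [Field F] {G A : Type*} [DecidableEq G]
    [NonUnitalNonAssocRing A] [Module F A] (E : G → A) (n : G → ℕ) (h : G) : Prop :=
  ∃ m, IsMultilinearMonomial n m ∧
    ∃ c : F, c ≠ 0 ∧ FreeMagma.lift (fun x : G × ℕ => E x.1) m = c • E h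

theorem IsRealized.single {F : Type*} [Field F] {G A : Type*} [DecidableEq G]
    [NonUnitalNonAssocRing A] [Module F A] (E : G → A) (g : G) : IsRealized F E (Pi.single g 1) g := by
  refine ⟨.of (g, 0), ?_, 1, one_ne_zero, by simp⟩
  rintro ⟨h, i⟩
  by_cases hh : h = g
  · subst hh
    cases i <;> simp [occurrences]
  · simp [occurrences, hh, Ne.symm hh]

section OneDimensionalComponents

variable {F : Type*} [Field F] {G : Type*} {A : Type*} [NonUnitalNonAssocRing A] [Module F A]
  [IsScalarTower F A A] [SMulCommClass F A A]

theorem freeMagma_lift_smul (E : G → A) (c : G × ℕ → F) (m : FreeMagma (G × ℕ)) :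
    FreeMagma.lift (fun x => c x • E x.1) m =
      ((monomialContent m).map c).prod • FreeMagma.lift (fun x => E x.1) m := by
  induction m with
  | ih1 x => simp [monomialContent]
  | ih2 u v hu hv =>
    rw [map_mul, map_mul, hu, hv, monomialContent_mul, Multiset.map_add, Multiset.prod_add,
      smul_mul_smul_comm]

theorem exists_freeMagma_lift_eq_smul [AddCommMonoid G] {E : G → A}
    (hE : ∀ g h, ∃ c : F, E g * E h = c • E (g + h)) (m : FreeMagma (G × ℕ)) :
    ∃ c : F, FreeMagma.lift (fun x => E x.1) m =
      c • E ((monomialContent m).map Prod.fst).sum := by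
  induction m with
  | ih1 x => exact ⟨1, by simp [monomialContent]⟩
  | ih2 u v hu hv =>
    obtain ⟨a, ha⟩ := hu
    obtain ⟨b, hb⟩ := hv
    obtain ⟨c, hc⟩ := hE ((monomialContent u).map Prod.fst).sum
      ((monomialContent v).map Prod.fst).sum
    refine ⟨a * b * c, ?_⟩
    rw [map_mul, ha, hb, monomialContent_mul, Multiset.map_add, Multiset.sum_add,
      smul_mul_smul_comm, hc, smul_smul]

/-- The weight z need not be a homomorphism on G; it is additive only along nonzero products. All
subproducts of a nonzero monomial are nonzero, which is enough. -/
theorem sum_degree_of_freeMagma_lift_ne_zero [AddCommMonoid G] {E : G → A}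
    (hE : ∀ g h, ∃ c : F, E g * E h = c • E (g + h)) {z : G → ℤ}
    (hz : ∀ g h, E g * E h ≠ 0 → z (g + h) = z g + z h) (m : FreeMagma (G × ℕ))
    (hm : FreeMagma.lift (fun x => E x.1) m ≠ 0) :
    z ((monomialContent m).map Prod.fst).sum =
      ((monomialContent m).map (fun x => z x.1)).sum := by
  induction m with
  | ih1 x => simp [monomialContent]
  | ih2 u v hu hv =>
    rw [map_mul] at hm
    have hu0 := left_ne_zero_of_mul hm
    have hv0 := right_ne_zero_of_mul hm
    obtain ⟨a, ha⟩ := exists_freeMagma_lift_eq_smul (F := F) hE u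
    obtain ⟨b, hb⟩ := exists_freeMagma_lift_eq_smul (F := F) hE v
    rw [ha, hb, smul_mul_smul_comm] at hm
    rw [monomialContent_mul, Multiset.map_add, Multiset.map_add, Multiset.sum_add,
      Multiset.sum_add, hz _ _ (right_ne_zero_of_smul hm), hu hu0, hv hv0]

theorem ne_zero_of_freeMagma_lift_ne_zero {E : G → A} (m : FreeMagma (G × ℕ))
    (hm : FreeMagma.lift (fun x => E x.1) m ≠ 0) : ∀ x ∈ monomialContent m, E x.1 ≠ 0 := by
  induction m with
  | ih1 x => simpa [monomialContent] using hm
  | ih2 u v hu hv =>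
    rw [map_mul] at hm
    intro x hx
    rcases Multiset.mem_add.mp hx with h | h
    · exact hu (left_ne_zero_of_mul hm) x h
    · exact hv (right_ne_zero_of_mul hm) x h

theorem IsRealized.mul [DecidableEq G] {E : G → A} {n n' : G → ℕ} {h h' k : G} (hn : IsRealized F E n h)
    (hn' : IsRealized F E n' h') (hk : ∃ c : F, c ≠ 0 ∧ E h * E h' = c • E k) :
    IsRealized F E (n + n') k := by
  obtain ⟨m, hm, a, ha, hma⟩ := hn
  obtain ⟨m', hm', b, hb, hmb⟩ := hn'
  obtain ⟨c, hc, hhk⟩ := hk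
  refine ⟨m * FreeMagma.map (fun y : G × ℕ => (y.1, y.2 + n y.1)) m', fun x => ?_,
    a * b * c, mul_ne_zero (mul_ne_zero ha hb) hc, ?_⟩
  · change occurrences x m + occurrences x (FreeMagma.map _ m') = _
    rw [occurrences_map_shift, hm x, hm' _]
    simp only [Pi.add_apply]
    split_ifs <;> omega
  · have hcomp : ∀ u : FreeMagma (G × ℕ),
        FreeMagma.lift (fun x : G × ℕ => E x.1)
          (FreeMagma.map (fun y : G × ℕ => (y.1, y.2 + n y.1)) u) =
        FreeMagma.lift (fun x : G × ℕ => E x.1) u := by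
      intro u
      induction u with
      | ih1 x => simp
      | ih2 u v hu hv => simp only [map_mul, hu, hv]
    rw [map_mul, hcomp, hma, hmb, smul_mul_smul_comm, hhk, smul_smul]

variable [Fintype G] [DecidableEq G]

/-- Replacing each E g by scalar multiples rescales every monomial of type n by the same product of
scalars, so one substitution tests the identity. -/
theorem mem_gradedIdentities_iff {𝒜 : G → Submodule F A} {E : G → A}
    (h𝒜 : ∀ g, 𝒜 g = Submodule.span F {E g}) (n : G → ℕ) {f : FreeGradedAlgebra F G}
    (hf : f ∈ multilinearPolynomials F n) :
    f ∈ gradedIdentities F 𝒜 ↔ FreeNonUnitalNonAssocAlgebra.lift F (fun x => E x.1) f = 0 := by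
  constructor
  · intro h
    refine h _ fun x => ?_
    rw [h𝒜]
    exact Submodule.mem_span_singleton_self _
  · intro h φ hφ
    have hc : ∀ x, ∃ c : F, φ x = c • E x.1 := fun x => by
      have := hφ x
      rw [h𝒜, Submodule.mem_span_singleton] at this
      obtain ⟨c, hc⟩ := this
      exact ⟨c, hc.symm⟩
    choose c hc using hc
    obtain rfl : φ = fun x => c x • E x.1 := funext hc
    have key : FreeNonUnitalNonAssocAlgebra.lift F (fun x => c x • E x.1) f =
        ((standardVariables n).map c).prod •
          FreeNonUnitalNonAssocAlgebra.lift F (fun x => E x.1) f := by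
      clear h
      induction hf using Submodule.span_induction with
      | mem f hf =>
        obtain ⟨m, hm, rfl⟩ := hf
        rw [lift_ofMagma, lift_ofMagma, freeMagma_lift_smul,
          (isMultilinearMonomial_iff n m).mp hm]
      | zero => simp
      | add f g _ _ hf hg => rw [map_add, map_add, hf, hg, smul_add]
      | smul a f _ hf => rw [map_smul, map_smul, hf, smul_comm]
    rw [key, h, smul_zero]

theorem partialCodimension_eq_finrank {𝒜 : G → Submodule F A} {E : G → A}
    (h𝒜 : ∀ g, 𝒜 g = Submodule.span F {E g}) (n : G → ℕ) :
    partialCodimension F 𝒜 n = Module.finrank F (Submodule.span F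
      {a | ∃ m, IsMultilinearMonomial n m ∧ a = FreeMagma.lift (fun x => E x.1) m}) := by
  let ev : FreeGradedAlgebra F G →ₗ[F] A :=
    (FreeNonUnitalNonAssocAlgebra.lift F (fun x : G × ℕ => E x.1) : FreeGradedAlgebra F G →ₗ[F] A)
  have hker : (gradedIdentities F 𝒜).comap (multilinearPolynomials F n).subtype =
      LinearMap.ker (ev ∘ₗ (multilinearPolynomials F n).subtype) := by
    ext ⟨f, hf⟩
    exact mem_gradedIdentities_iff h𝒜 n hf
  have hrange : LinearMap.range (ev ∘ₗ (multilinearPolynomials F n).subtype) = Submodule.span F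
      {a | ∃ m, IsMultilinearMonomial n m ∧ a = FreeMagma.lift (fun x => E x.1) m} := by
    rw [LinearMap.range_comp, Submodule.range_subtype, multilinearPolynomials, Submodule.map_span]
    congr 1
    ext a
    constructor
    · rintro ⟨_, ⟨m, hm, rfl⟩, rfl⟩
      exact ⟨m, hm, lift_ofMagma F _ m⟩
    · rintro ⟨m, hm, rfl⟩
      exact ⟨_, ⟨m, hm, rfl⟩, lift_ofMagma F _ m⟩
  rw [partialCodimension, ← hrange]
  exact ((Submodule.quotEquivOfEq _ _ hker).trans (LinearMap.quotKerEquivRange _)).finrank_eq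

theorem span_values_le_span_singleton [AddCommMonoid G] {E : G → A}
    (hE : ∀ g h, ∃ c : F, E g * E h = c • E (g + h)) (n : G → ℕ) :
    Submodule.span F {a | ∃ m, IsMultilinearMonomial n m ∧
        a = FreeMagma.lift (fun x => E x.1) m} ≤
      Submodule.span F {E ((standardVariables n).map Prod.fst).sum} := by
  rw [Submodule.span_le]
  rintro _ ⟨m, hm, rfl⟩
  obtain ⟨c, hc⟩ := exists_freeMagma_lift_eq_smul (F := F) hE m
  rw [hc, (isMultilinearMonomial_iff n m).mp hm]
  exact Submodule.smul_mem _ _ (Submodule.mem_span_singleton_self _)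

theorem partialCodimension_le_one [AddCommMonoid G] {𝒜 : G → Submodule F A} {E : G → A}
    (h𝒜 : ∀ g, 𝒜 g = Submodule.span F {E g})
    (hE : ∀ g h, ∃ c : F, E g * E h = c • E (g + h)) (n : G → ℕ) :
    partialCodimension F 𝒜 n ≤ 1 := by
  rw [partialCodimension_eq_finrank h𝒜]
  exact (Submodule.finrank_mono (span_values_le_span_singleton hE n)).trans
    ((finrank_span_le_card _).trans (by simp))

theorem exists_freeMagma_lift_ne_zero {𝒜 : G → Submodule F A} {E : G → A}
    (h𝒜 : ∀ g, 𝒜 g = Submodule.span F {E g}) {n : G → ℕ} (hn : partialCodimension F 𝒜 n ≠ 0) :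
    ∃ m, IsMultilinearMonomial n m ∧ FreeMagma.lift (fun x => E x.1) m ≠ 0 := by
  by_contra! H
  refine hn ?_
  rw [partialCodimension_eq_finrank h𝒜, Submodule.span_eq_bot.mpr]
  · exact finrank_bot F A
  · rintro _ ⟨m, hm, rfl⟩
    exact H m hm

theorem IsRealized.partialCodimension_eq_one [AddCommMonoid G] {𝒜 : G → Submodule F A} {E : G → A}
    (h𝒜 : ∀ g, 𝒜 g = Submodule.span F {E g})
    (hE : ∀ g h, ∃ c : F, E g * E h = c • E (g + h)) {n : G → ℕ} {h : G}
    (hn : IsRealized F E n h) (hh : E h ≠ 0) : partialCodimension F 𝒜 n = 1 := by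
  refine le_antisymm (partialCodimension_le_one h𝒜 hE n) ?_
  obtain ⟨m, hm, a, ha, hma⟩ := hn
  rw [partialCodimension_eq_finrank h𝒜, ← finrank_span_singleton (K := F) hh]
  -- `A` is not assumed finite-dimensional, and `finrank` is monotone only inside a
  -- finite-dimensional space.
  have := Submodule.finiteDimensional_of_le (span_values_le_span_singleton hE n)
  refine Submodule.finrank_mono ?_
  rw [Submodule.span_singleton_le_iff_mem]
  have := Submodule.smul_mem _ a⁻¹ (Submodule.subset_span (R := F) (s := {a | ∃ m,
    IsMultilinearMonomial n m ∧ a = FreeMagma.lift (fun x => E x.1) m}) ⟨m, hm, rfl⟩)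
  rwa [hma, smul_smul, inv_mul_cancel₀ ha, one_smul] at this

end OneDimensionalComponents

/-! ### Exponential growth of restricted sums of multinomial coefficients -/

theorem multinomial_le_multinomial_add {ι : Type*} [DecidableEq ι] (s : Finset ι) (n d : ι → ℕ) :
    Nat.multinomial s n ≤ Nat.multinomial s (n + d) := by
  induction s using Finset.induction_on with
  | empty => simp
  | insert a s ha ih =>
    rw [Nat.multinomial_insert ha, Nat.multinomial_insert ha]
    refine Nat.mul_le_mul ?_ ih
    have h1 : ∑ i ∈ s, n i ≤ ∑ i ∈ s, (n + d) i :=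
      Finset.sum_le_sum fun i _ => Nat.le_add_right _ _
    calc (n a + ∑ i ∈ s, n i).choose (n a)
        ≤ (n a + ∑ i ∈ s, (n + d) i).choose (n a) := Nat.choose_le_choose _ (by omega)
      _ = (n a + ∑ i ∈ s, (n + d) i).choose (∑ i ∈ s, (n + d) i) := Nat.choose_symm_add
      _ ≤ ((n + d) a + ∑ i ∈ s, (n + d) i).choose (∑ i ∈ s, (n + d) i) :=
        Nat.choose_le_choose _ (by simp only [Pi.add_apply]; omega)
      _ = ((n + d) a + ∑ i ∈ s, (n + d) i).choose ((n + d) a) := Nat.choose_symm_add.symm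

/-- The functions `n : G → ℕ` of total `N` which vanish outside `s` and have weight
`∑ g, n g * z g` equal to zero. -/
def balancedTypes {G : Type*} [Fintype G] [DecidableEq G] (s : Finset G) (z : G → ℤ) (N : ℕ) :
    Finset (G → ℕ) :=
  (Finset.piAntidiag Finset.univ N).filter
    fun n => (∀ g, g ∉ s → n g = 0) ∧ ∑ g, (n g : ℤ) * z g = 0

-- Shifting the weights by one makes the exponents natural numbers; total weight 0 over N factors
-- then means exponent N.
open Polynomial in
theorem sum_multinomial_balancedTypes {G : Type*} [Fintype G] [DecidableEq G] (s : Finset G)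
    (z : G → ℤ) (e : G → ℕ) (hz : ∀ g, z g = e g - 1) (N : ℕ) :
    ∑ n ∈ balancedTypes s z N, Nat.multinomial Finset.univ n =
      ((∑ g ∈ s, (X : ℕ[X]) ^ e g) ^ N).coeff N := by
  have h1 : ∑ g ∈ s, (X : ℕ[X]) ^ e g = ∑ g, if g ∈ s then (X : ℕ[X]) ^ e g else 0 := by
    rw [Finset.sum_ite_mem, Finset.univ_inter]
  rw [h1, Finset.sum_pow_eq_sum_piAntidiag, finsetSum_coeff, balancedTypes, Finset.sum_filter]
  refine Finset.sum_congr rfl fun n hn => ?_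
  rw [Finset.mem_piAntidiag] at hn
  by_cases hs : ∀ g, g ∉ s → n g = 0
  · have h2 : ∏ g, (if g ∈ s then (X : ℕ[X]) ^ e g else 0) ^ n g = X ^ ∑ g, e g * n g := by
      rw [← Finset.prod_pow_eq_pow_sum]
      refine Finset.prod_congr rfl fun g _ => ?_
      split_ifs with hg
      · rw [pow_mul]
      · rw [hs g hg, mul_zero, pow_zero, pow_zero]
    have h3 : ∑ g, (n g : ℤ) * z g = (∑ g, e g * n g : ℕ) - (N : ℤ) := by
      rw [← hn.1]
      push_cast
      rw [← Finset.sum_sub_distrib]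
      exact Finset.sum_congr rfl fun g _ => by rw [hz]; ring
    rw [h2, ← C_eq_natCast, coeff_C_mul, coeff_X_pow, h3]
    by_cases h4 : N = ∑ g, e g * n g
    · rw [if_pos ⟨hs, by omega⟩, if_pos h4]
      simp
    · rw [if_neg (fun h => h4 (by omega)), if_neg h4, mul_zero]
  · rw [if_neg (fun h => hs h.1)]
    push Not at hs
    obtain ⟨g, hg, hg0⟩ := hs
    rw [Finset.prod_eq_zero (Finset.mem_univ g), mul_zero, coeff_zero]
    rw [if_neg hg, zero_pow hg0]

-- Let j be the number of factors contributing bX^2 + c. For even j = 2i, the monomial X^N requires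
-- i choices of each of its two terms, whence the central binomial coefficient.
open Polynomial in
theorem coeff_linear_pow_ge (a b c N : ℕ) :
    ∑ j ∈ Finset.range (N + 1), (if Even j then
        a ^ (N - j) * ((b * c) ^ (j / 2) * Nat.centralBinom (j / 2)) * N.choose j else 0) ≤
      (((C b * X ^ 2 + C c) + C a * X : ℕ[X]) ^ N).coeff N := by
  rw [add_pow, finsetSum_coeff]
  refine Finset.sum_le_sum fun j hj => ?_
  split_ifs with hj2
  · obtain ⟨i, rfl⟩ := hj2
    have hjN : i + i ≤ N := by simpa [Nat.lt_succ_iff] using hj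
    have h1 : (b * c) ^ i * Nat.centralBinom i ≤
        ((C b * X ^ 2 + C c : ℕ[X]) ^ (i + i)).coeff (i + i) := by
      rw [add_pow, finsetSum_coeff]
      refine le_trans (le_of_eq ?_) (Finset.single_le_sum (fun _ _ => Nat.zero_le _)
        (Finset.mem_range.mpr (by omega : i < i + i + 1)))
      rw [mul_pow (C b), ← pow_mul, ← C_pow, ← C_pow, ← C_eq_natCast, mul_assoc, ← C_mul, mul_assoc,
        X_pow_mul_C, ← mul_assoc, ← C_mul, coeff_C_mul, coeff_X_pow,
        if_pos (two_mul i).symm, Nat.add_sub_cancel, Nat.centralBinom, two_mul, mul_pow,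
        Nat.cast_id]
      ring
    have h2 : (((C b * X ^ 2 + C c : ℕ[X]) ^ (i + i)) * (C a * X) ^ (N - (i + i)) *
        ((N.choose (i + i) : ℕ) : ℕ[X])).coeff N =
        ((C b * X ^ 2 + C c : ℕ[X]) ^ (i + i)).coeff (i + i) * a ^ (N - (i + i)) *
          N.choose (i + i) := by
      rw [← C_eq_natCast, coeff_mul_C, mul_pow, ← C_pow, ← mul_assoc, coeff_mul_X_pow',
        if_pos (Nat.sub_le _ _), coeff_mul_C, Nat.sub_sub_self hjN]
      simp
    rw [h2, ← two_mul, Nat.mul_div_cancel_left _ two_pos, two_mul, mul_comm (a ^ _)]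
    gcongr
  · exact Nat.zero_le _

/-- The even part of the binomial expansion is ((a+b)^N + (a-b)^N)/2, and the hypothesis bounds the
second power by half of the first. -/
theorem add_pow_le_sum_even {a b : ℝ} (hab : |a - b| ≤ (a + b) / 2) {N : ℕ} (hN : 1 ≤ N) :
    (a + b) ^ N / 4 ≤ ∑ j ∈ Finset.range (N + 1),
      if Even j then a ^ (N - j) * b ^ j * N.choose j else 0 := by
  have h1 : ∑ j ∈ Finset.range (N + 1), (if Even j then a ^ (N - j) * b ^ j * N.choose j else 0) =
      ((a + b) ^ N + (a - b) ^ N) / 2 := by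
    rw [add_comm a b, add_pow, sub_eq_neg_add, add_pow, ← Finset.sum_add_distrib, Finset.sum_div]
    refine Finset.sum_congr rfl fun j _ => ?_
    split_ifs with h
    · rw [h.neg_pow]; ring
    · rw [(Nat.not_even_iff_odd.mp h).neg_pow]; ring
  have h0 : 0 ≤ a + b := by linarith [abs_nonneg (a - b)]
  have h2 : |(a - b) ^ N| ≤ (a + b) ^ N / 2 := by
    rw [abs_pow]
    calc |a - b| ^ N ≤ ((a + b) / 2) ^ N := pow_le_pow_left₀ (abs_nonneg _) hab N
      _ = (a + b) ^ N / 2 ^ N := div_pow _ _ _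
      _ ≤ (a + b) ^ N / 2 := by
        refine div_le_div_of_nonneg_left (pow_nonneg h0 N) two_pos ?_
        exact le_self_pow₀ one_le_two (by omega)
  rw [h1]
  linarith [(abs_le.mp h2).1]

/-- Since 4^i ≤ (2i+1) · `Nat.centralBinom i`, the term (bc)^i · `Nat.centralBinom i` is at least
r^(2i)/(N+1); the even part of (a + r)^N then appears. -/
theorem pow_le_sum_multinomial_balancedTypes {G : Type*} [Fintype G] [DecidableEq G]
    (s : Finset G) (z : G → ℤ) (hz : ∀ g, z g = -1 ∨ z g = 0 ∨ z g = 1) {a b c : ℕ}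
    (ha : (s.filter fun g => z g = 0).card = a) (hb : (s.filter fun g => z g = 1).card = b)
    (hc : (s.filter fun g => z g = -1).card = c) {r : ℝ} (hr : r ^ 2 = 4 * (b * c))
    (har : |a - r| ≤ (a + r) / 2) {N : ℕ} (hN : 1 ≤ N) :
    (a + r) ^ N ≤ 4 * (N + 1) *
      ((∑ n ∈ balancedTypes s z N, Nat.multinomial Finset.univ n : ℕ) : ℝ) := by
  have hsum : ∑ g ∈ s, (Polynomial.X : Polynomial ℕ) ^ (z g + 1).toNat =
      (Polynomial.C b * Polynomial.X ^ 2 + Polynomial.C c) + Polynomial.C a * Polynomial.X := by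
    have : ∀ g ∈ s, (Polynomial.X : Polynomial ℕ) ^ (z g + 1).toNat =
        ((if z g = 1 then Polynomial.X ^ 2 else 0) + (if z g = -1 then 1 else 0)) +
          (if z g = 0 then Polynomial.X else 0) := by
      intro g _
      rcases hz g with h | h | h <;> simp [h]
    rw [Finset.sum_congr rfl this, Finset.sum_add_distrib, Finset.sum_add_distrib,
      ← Finset.sum_filter, ← Finset.sum_filter, ← Finset.sum_filter, Finset.sum_const,
      Finset.sum_const, Finset.sum_const, ha, hb, hc]
    simp
  rw [sum_multinomial_balancedTypes s z (fun g => (z g + 1).toNat)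
    (fun g => by rcases hz g with h | h | h <;> simp [h]), hsum]
  have h1 := coeff_linear_pow_ge a b c N
  have h2 := add_pow_le_sum_even har hN
  have h3 : ∑ j ∈ Finset.range (N + 1),
      (if Even j then (a : ℝ) ^ (N - j) * r ^ j * N.choose j else 0) ≤ (N + 1) *
      ((∑ j ∈ Finset.range (N + 1), (if Even j then
        a ^ (N - j) * ((b * c) ^ (j / 2) * Nat.centralBinom (j / 2)) * N.choose j else 0) : ℕ)
          : ℝ) := by
    rw [Nat.cast_sum, Finset.mul_sum]
    refine Finset.sum_le_sum fun j hj => ?_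
    split_ifs with hj2
    · obtain ⟨i, rfl⟩ := hj2
      rw [← two_mul] at hj ⊢
      rw [Nat.mul_div_cancel_left _ two_pos, pow_mul, hr, mul_pow]
      have h4 : (4 : ℝ) ^ i ≤ (N + 1) * Nat.centralBinom i := by
        have h5 : 4 ^ i ≤ (N + 1) * Nat.centralBinom i :=
          (Nat.four_pow_le_two_mul_add_one_mul_central_binom i).trans
            (Nat.mul_le_mul_right _ (by simpa using hj))
        exact_mod_cast h5
      push_cast
      calc (a : ℝ) ^ (N - 2 * i) * (4 ^ i * ((b : ℝ) * c) ^ i) * N.choose (2 * i)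
          ≤ (a : ℝ) ^ (N - 2 * i) * (((N + 1) * Nat.centralBinom i) * ((b : ℝ) * c) ^ i) *
            N.choose (2 * i) := by gcongr
        _ = _ := by ring
    · simp
  have h4 : ((∑ j ∈ Finset.range (N + 1), (if Even j then
        a ^ (N - j) * ((b * c) ^ (j / 2) * Nat.centralBinom (j / 2)) * N.choose j else 0) : ℕ)
          : ℝ) ≤ _ := Nat.cast_le.mpr h1
  have h5 := mul_le_mul_of_nonneg_left h4 (by positivity : (0 : ℝ) ≤ N + 1)
  linarith

theorem tendsto_rpow_one_div_of_growth {c : ℕ → ℝ} {r C D : ℝ} {K : ℕ} (hr : 0 < r) (hC : 0 < C)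
    (hD : 0 < D) (hlow : ∀ N, 1 ≤ N → r ^ N ≤ C * (N + 1) * c (N + K))
    (hup : ∀ N, c N ≤ D * r ^ N) :
    Tendsto (fun n : ℕ => c n ^ (1 / (n : ℝ))) atTop (𝓝 r) := by
  have hinv : Tendsto (fun n : ℕ => 1 / (n : ℝ)) atTop (𝓝 0) :=
    tendsto_one_div_atTop_nhds_zero_nat
  have hconst : ∀ x : ℝ, 0 < x → Tendsto (fun n : ℕ => x ^ (1 / (n : ℝ))) atTop (𝓝 1) := by
    intro x hx
    have := (Real.continuousAt_const_rpow (a := x) hx.ne').tendsto.comp hinv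
    rwa [Real.rpow_zero] at this
  have hlin : Tendsto (fun n : ℕ => ((n : ℝ) + 1) ^ (1 / (n : ℝ))) atTop (𝓝 1) := by
    have h1 := (tendsto_rpow_div_mul_add 1 1 (-1) one_ne_zero.symm).comp
      (tendsto_natCast_atTop_atTop (R := ℝ) |>.comp (tendsto_add_atTop_nat 1))
    refine h1.congr fun n => ?_
    simp
  have hroot : ∀ n : ℕ, 1 ≤ n → (r ^ n) ^ (1 / (n : ℝ)) = r := by
    intro n hn
    rw [one_div, Real.pow_rpow_inv_natCast hr.le (by omega)]
  have hE : 0 < C * r ^ K := by positivity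
  have hlow' : Tendsto (fun n : ℕ => r / ((C * r ^ K) ^ (1 / (n : ℝ)) *
      ((n : ℝ) + 1) ^ (1 / (n : ℝ)))) atTop (𝓝 r) := by
    have := (tendsto_const_nhds (x := r)).div ((hconst _ hE).mul hlin) (by norm_num)
    rw [mul_one, div_one] at this
    exact this
  have hup' : Tendsto (fun n : ℕ => D ^ (1 / (n : ℝ)) * r) atTop (𝓝 r) := by
    simpa using (hconst D hD).mul_const r
  have hle : ∀ n, K + 1 ≤ n → r ^ n / ((C * r ^ K) * (n + 1)) ≤ c n := by
    intro n hn
    obtain ⟨N, rfl⟩ := Nat.exists_eq_add_of_le' (Nat.le_of_succ_le hn)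
    have hN := hlow N (by omega)
    -- Nonnegativity of c is not assumed; it follows from the lower bound for large indices.
    have hc : 0 ≤ c (N + K) := by
      have : 0 < C * (N + 1) * c (N + K) := lt_of_lt_of_le (pow_pos hr N) hN
      exact (pos_of_mul_pos_right this (by positivity)).le
    rw [div_le_iff₀ (by positivity), pow_add]
    push_cast
    calc r ^ N * r ^ K ≤ (C * (N + 1) * c (N + K)) * r ^ K := by gcongr
      _ ≤ (C * (N + K + 1) * c (N + K)) * r ^ K := by
        gcongr
        linarith [(Nat.cast_nonneg K : (0 : ℝ) ≤ K)]
      _ = _ := by ring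
  refine tendsto_of_tendsto_of_tendsto_of_le_of_le' hlow' hup' ?_ ?_
  · filter_upwards [eventually_ge_atTop (K + 1)] with n hn
    rw [← Real.mul_rpow hE.le (by positivity)]
    nth_rewrite 1 [← hroot n (by omega)]
    rw [← Real.div_rpow (by positivity) (by positivity)]
    exact Real.rpow_le_rpow (by positivity) (hle n hn) (by positivity)
  · filter_upwards [eventually_ge_atTop (K + 1)] with n hn
    have h0 : 0 ≤ c n := le_trans (by positivity) (hle n hn)
    conv_rhs => rw [← hroot n (by omega), ← Real.mul_rpow hD.le (by positivity)]
    exact Real.rpow_le_rpow h0 (hup n) (by positivity)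

/-! ### Bounds for graded codimensions -/

section CodimensionBounds

variable {F : Type*} [Field F] {G : Type*} {A : Type*} [NonUnitalNonAssocRing A] [Module F A]
  [IsScalarTower F A A] [SMulCommClass F A A] [Fintype G] [DecidableEq G]
  {𝒜 : G → Submodule F A} {E : G → A} {s : Finset G} {z : G → ℤ}

theorem support_and_weight_of_partialCodimension_ne_zero [AddCommMonoid G]
    (h𝒜 : ∀ g, 𝒜 g = Submodule.span F {E g})
    (hE : ∀ g h, ∃ c : F, E g * E h = c • E (g + h)) (hs : ∀ g, g ∉ s → E g = 0)
    (hz : ∀ g h, E g * E h ≠ 0 → z (g + h) = z g + z h) {n : G → ℕ}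
    (hn : partialCodimension F 𝒜 n ≠ 0) :
    (∀ g, g ∉ s → n g = 0) ∧ ∃ h, ∑ g, (n g : ℤ) * z g = z h := by
  obtain ⟨m, hm, hm0⟩ := exists_freeMagma_lift_ne_zero h𝒜 hn
  have hc := (isMultilinearMonomial_iff n m).mp hm
  constructor
  · intro g hg
    by_contra h0
    refine ne_zero_of_freeMagma_lift_ne_zero m hm0 (g, 0) ?_ (hs g hg)
    rw [hc, ← Multiset.count_pos, count_standardVariables, if_pos (Nat.pos_of_ne_zero h0)]
    exact one_pos
  · refine ⟨((monomialContent m).map Prod.fst).sum, ?_⟩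
    rw [sum_degree_of_freeMagma_lift_ne_zero (F := F) hE hz m hm0, hc, sum_map_standardVariables]
    simp

/-- Weight each variable of degree g by w^(z g). A contributing type has total weight z h for some
h, so its weighted multinomial is at least 1/D times the plain one, and the weighted multinomials
sum to the power on the right. -/
theorem gradedCodimension_le_pow [AddCommMonoid G]
    (h𝒜 : ∀ g, 𝒜 g = Submodule.span F {E g})
    (hE : ∀ g h, ∃ c : F, E g * E h = c • E (g + h)) (hs : ∀ g, g ∉ s → E g = 0)
    (hz : ∀ g h, E g * E h ≠ 0 → z (g + h) = z g + z h)
    {w : ℝ} (hw : 0 < w) {D : ℝ} (hD : ∀ g, 1 ≤ D * w ^ z g) (hD0 : 0 ≤ D) (N : ℕ) :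
    (gradedCodimension F 𝒜 N : ℝ) ≤ D * (∑ g ∈ s, w ^ z g) ^ N := by
  have h1 : ∑ g ∈ s, w ^ z g = ∑ g, if g ∈ s then w ^ z g else 0 := by
    rw [Finset.sum_ite_mem, Finset.univ_inter]
  rw [h1, Finset.sum_pow_eq_sum_piAntidiag, gradedCodimension, Nat.cast_sum, Finset.mul_sum]
  refine Finset.sum_le_sum fun n _ => ?_
  have hpos : ∀ g, 0 ≤ (if g ∈ s then w ^ z g else 0) := fun g => by
    split_ifs
    · positivity
    · exact le_rfl
  by_cases hn : partialCodimension F 𝒜 n = 0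
  · rw [hn, mul_zero, Nat.cast_zero]
    exact mul_nonneg hD0 (mul_nonneg (Nat.cast_nonneg _)
      (Finset.prod_nonneg fun g _ => pow_nonneg (hpos g) _))
  · obtain ⟨hns, h, hh⟩ := support_and_weight_of_partialCodimension_ne_zero h𝒜 hE hs hz hn
    have hprod : ∏ g, (if g ∈ s then w ^ z g else 0) ^ n g = w ^ z h := by
      have h2 : ∀ g ∈ Finset.univ, (if g ∈ s then w ^ z g else 0) ^ n g =
          w ^ ((n g : ℤ) * z g) := by
        intro g _
        split_ifs with hg
        · rw [mul_comm, _root_.zpow_mul, zpow_natCast]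
        · simp [hns g hg]
      rw [Finset.prod_congr rfl h2, ← hh]
      induction (Finset.univ : Finset G) using Finset.induction_on with
      | empty => simp
      | insert a t ha ih => rw [Finset.prod_insert ha, Finset.sum_insert ha, ih, zpow_add₀ hw.ne']
    have hle := partialCodimension_le_one h𝒜 hE n
    rw [hprod, show partialCodimension F 𝒜 n = 1 by omega, mul_one]
    calc (Nat.multinomial Finset.univ n : ℝ) = Nat.multinomial Finset.univ n * 1 := by ring
      _ ≤ Nat.multinomial Finset.univ n * (D * w ^ z h) := by gcongr; exact hD h
      _ = _ := by ring

/-- The padding d depends on n, so the sum runs over all d of total K. For fixed d the map n ↦ n + d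
is injective and does not decrease multinomials, so each d costs at most one copy of the
codimension. -/
theorem sum_multinomial_balancedTypes_le_mul_gradedCodimension {K : ℕ}
    (hK : ∀ N, ∀ n ∈ balancedTypes s z N,
      ∃ d : G → ℕ, ∑ g, d g = K ∧ partialCodimension F 𝒜 (n + d) ≠ 0) (N : ℕ) :
    ∑ n ∈ balancedTypes s z N, Nat.multinomial Finset.univ n ≤
      (Finset.piAntidiag (Finset.univ : Finset G) K).card * gradedCodimension F 𝒜 (N + K) := by
  have hterm : ∀ n ∈ balancedTypes s z N, Nat.multinomial Finset.univ n ≤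
      ∑ d ∈ Finset.piAntidiag (Finset.univ : Finset G) K,
        Nat.multinomial Finset.univ (n + d) * partialCodimension F 𝒜 (n + d) := by
    intro n hn
    obtain ⟨d, hd, hpc⟩ := hK N n hn
    refine le_trans ?_ (Finset.single_le_sum (fun _ _ => Nat.zero_le _)
      (show d ∈ Finset.piAntidiag (Finset.univ : Finset G) K by simpa using hd))
    exact (multinomial_le_multinomial_add _ n d).trans
      (Nat.le_mul_of_pos_right _ (Nat.pos_of_ne_zero hpc))
  refine (Finset.sum_le_sum hterm).trans ?_
  rw [Finset.sum_comm, ← smul_eq_mul]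
  refine Finset.sum_le_card_nsmul _ _ _ fun d hd => ?_
  rw [gradedCodimension]
  refine (Finset.sum_map _ (addRightEmbedding d) (fun n =>
    Nat.multinomial Finset.univ n * partialCodimension F 𝒜 n)).symm.trans_le ?_
  refine Finset.sum_le_sum_of_subset fun n' hn' => ?_
  obtain ⟨n, hn, rfl⟩ := Finset.mem_map.mp hn'
  have h1 := (Finset.mem_piAntidiag.mp (Finset.mem_filter.mp hn).1).1
  have h2 := (Finset.mem_piAntidiag.mp hd).1
  simp only [Finset.mem_piAntidiag, addRightEmbedding_apply, Pi.add_apply, Finset.mem_univ,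
    implies_true, and_true]
  rw [← h1, ← h2]
  exact Finset.sum_add_distrib

end CodimensionBounds

/-! ### Products of Pauli tensors -/

section PauliTensor

theorem zmod_two_eq_zero_or_one (a : ZMod 2) : a = 0 ∨ a = 1 := by
  fin_cases a
  · exact Or.inl rfl
  · exact Or.inr rfl

/-- The sign `(-1)^a`. -/
def parity (F : Type*) [Field F] (a : ZMod 2) : F := if a = 0 then 1 else -1

theorem parity_add (F : Type*) [Field F] (a b : ZMod 2) :
    parity F (a + b) = parity F a * parity F b := by
  have h2 : (1 : ZMod 2) + 1 = 0 := rfl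
  rcases zmod_two_eq_zero_or_one a with rfl | rfl <;>
    rcases zmod_two_eq_zero_or_one b with rfl | rfl <;> simp [parity, h2]

theorem parity_sum (F : Type*) [Field F] {ι : Type*} (s : Finset ι) (a : ι → ZMod 2) :
    parity F (∑ k ∈ s, a k) = ∏ k ∈ s, parity F (a k) := by
  classical
  induction s using Finset.induction_on with
  | empty => simp [parity]
  | insert k s hk ih => rw [Finset.sum_insert hk, Finset.prod_insert hk, parity_add, ih]

theorem parity_ne_zero (F : Type*) [Field F] (a : ZMod 2) : parity F a ≠ 0 := by
  unfold parity
  split_ifs <;> simp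

/-- The bilinear form with `T_g T_h = (-1)^{β(g, h)} T_{g + h}` for the Pauli tensors `T_g`. -/
def pauliForm {q : ℕ} (g h : PauliGroupZero q) : ZMod 2 := ∑ k, (g k).2 * (h k).1

theorem pauliForm_add_left {q : ℕ} (g g' h : PauliGroupZero q) :
    pauliForm (g + g') h = pauliForm g h + pauliForm g' h := by
  simp [pauliForm, add_mul, Finset.sum_add_distrib]

theorem pauliForm_add_right {q : ℕ} (g h h' : PauliGroupZero q) :
    pauliForm g (h + h') = pauliForm g h + pauliForm g h' := by
  simp [pauliForm, mul_add, Finset.sum_add_distrib]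

variable (F : Type*) [Field F]

theorem pauliMatrix_mul (u v : ZMod 2 × ZMod 2) :
    pauliMatrix F u * pauliMatrix F v = parity F (u.2 * v.1) • pauliMatrix F (u + v) := by
  obtain ⟨a, b⟩ := u
  obtain ⟨c, d⟩ := v
  have h2 : (1 : ZMod 2) + 1 = 0 := rfl
  rcases zmod_two_eq_zero_or_one a with rfl | rfl <;>
    rcases zmod_two_eq_zero_or_one b with rfl | rfl <;>
    rcases zmod_two_eq_zero_or_one c with rfl | rfl <;>
    rcases zmod_two_eq_zero_or_one d with rfl | rfl <;>
    ext i j <;> fin_cases i <;> fin_cases j <;>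
    simp [pauliMatrix, parity, Matrix.mul_apply, Fin.sum_univ_two, h2]

theorem pauliMatrix_transpose (u : ZMod 2 × ZMod 2) :
    (pauliMatrix F u)ᵀ = parity F (u.2 * u.1) • pauliMatrix F u := by
  obtain ⟨a, b⟩ := u
  rcases zmod_two_eq_zero_or_one a with rfl | rfl <;>
    rcases zmod_two_eq_zero_or_one b with rfl | rfl <;>
    ext i j <;> fin_cases i <;> fin_cases j <;> simp [pauliMatrix, parity]

variable {q : ℕ}

theorem pauliTensor_mul (g h : PauliGroupZero q) :
    pauliTensor F g * pauliTensor F h = parity F (pauliForm g h) • pauliTensor F (g + h) := by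
  ext i j
  simp only [Matrix.mul_apply, pauliTensor, Matrix.of_apply, Matrix.smul_apply, smul_eq_mul,
    ← Finset.prod_mul_distrib]
  have h1 := Finset.prod_univ_sum (fun _ : Fin q => (Finset.univ : Finset (Fin 2)))
    (fun k l => pauliMatrix F (g k) (i k) l * pauliMatrix F (h k) l (j k))
  rw [Fintype.piFinset_univ] at h1
  rw [← h1, pauliForm, parity_sum, ← Finset.prod_mul_distrib]
  refine Finset.prod_congr rfl fun k _ => ?_
  rw [← Matrix.mul_apply, pauliMatrix_mul]
  rfl

theorem pauliTensor_transpose (g : PauliGroupZero q) :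
    (pauliTensor F g)ᵀ = parity F (pauliForm g g) • pauliTensor F g := by
  ext i j
  simp only [Matrix.transpose_apply, pauliTensor, Matrix.of_apply, Matrix.smul_apply, smul_eq_mul]
  rw [pauliForm, parity_sum, ← Finset.prod_mul_distrib]
  refine Finset.prod_congr rfl fun k _ => ?_
  rw [← Matrix.transpose_apply (pauliMatrix F (g k)), pauliMatrix_transpose]
  rfl

theorem pauliTensor_zero : pauliTensor F (0 : PauliGroupZero q) = 1 := by
  ext i j
  have h1 : pauliMatrix F 0 = 1 := by
    ext i j
    fin_cases i <;> fin_cases j <;> simp [pauliMatrix]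
  simp only [pauliTensor, Matrix.of_apply, Pi.zero_apply, h1, Matrix.one_apply,
    Finset.prod_ite_zero, Finset.prod_const_one, Finset.mem_univ, true_implies, funext_iff]

theorem add_self_pauliGroupZero (g : PauliGroupZero q) : g + g = 0 := by
  funext k
  exact Prod.ext (CharTwo.add_self_eq_zero _) (CharTwo.add_self_eq_zero _)

theorem pauliTensor_ne_zero (g : PauliGroupZero q) : pauliTensor F g ≠ 0 := by
  intro h
  have h1 := pauliTensor_mul F g g
  rw [h, zero_mul, add_self_pauliGroupZero, pauliTensor_zero, eq_comm, smul_eq_zero] at h1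
  exact h1.elim (parity_ne_zero F _) one_ne_zero

/-- The symmetrized form equals 1 exactly when T_y and T_g anticommute. It is nondegenerate, as one
tensor position with nonzero entry already shows. -/
theorem exists_pauliForm_add_eq_one {g : PauliGroupZero q} (hg : g ≠ 0) :
    ∃ y, pauliForm y g + pauliForm g y = 1 := by
  obtain ⟨k, hk⟩ := Function.ne_iff.mp hg
  have hform : ∀ u : ZMod 2 × ZMod 2, pauliForm (Pi.single k u) g + pauliForm g (Pi.single k u) =
      u.2 * (g k).1 + (g k).2 * u.1 := by
    intro u
    rw [pauliForm, pauliForm, Finset.sum_eq_single k, Finset.sum_eq_single k]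
    · simp
    all_goals simp +contextual
  have hcase : ∀ u : ZMod 2 × ZMod 2, u ≠ 0 → ∃ v : ZMod 2 × ZMod 2,
      v.2 * u.1 + u.2 * v.1 = 1 := by decide
  obtain ⟨v, hv⟩ := hcase (g k) hk
  exact ⟨Pi.single k v, by rw [hform, hv]⟩

/-- A group is not the union of two proper subgroups: one of y, y', y + y' works. -/
theorem exists_pauliForm_add_eq_one_both {g h : PauliGroupZero q} (hg : g ≠ 0) (hh : h ≠ 0) :
    ∃ y, pauliForm y g + pauliForm g y = 1 ∧ pauliForm y h + pauliForm h y = 1 := by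
  obtain ⟨y, hy⟩ := exists_pauliForm_add_eq_one hg
  obtain ⟨y', hy'⟩ := exists_pauliForm_add_eq_one hh
  rcases zmod_two_eq_zero_or_one (pauliForm y h + pauliForm h y) with h1 | h1
  · rcases zmod_two_eq_zero_or_one (pauliForm y' g + pauliForm g y') with h2 | h2
    · refine ⟨y + y', ?_, ?_⟩
      · rw [pauliForm_add_left, pauliForm_add_right, add_add_add_comm, hy, h2, add_zero]
      · rw [pauliForm_add_left, pauliForm_add_right, add_add_add_comm, hy', h1, zero_add]
    · exact ⟨y', h2, hy'⟩
  · exact ⟨y, hy, h1⟩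

/-- For T_y anticommuting with T_g, cyclicity gives tr(T_y T_g T_y) = 0, while T_y T_g T_y = ±T_g.
-/
theorem trace_pauliTensor [CharZero F] {g : PauliGroupZero q} (hg : g ≠ 0) :
    (pauliTensor F g).trace = 0 := by
  obtain ⟨y, hy⟩ := exists_pauliForm_add_eq_one hg
  have h1 : pauliTensor F y * (pauliTensor F y * pauliTensor F g) =
      -(pauliTensor F y * pauliTensor F g * pauliTensor F y) := by
    have h2 : parity F (pauliForm y g) = -parity F (pauliForm g y) := by
      have h3 : pauliForm y g = pauliForm g y + 1 := by
        rw [← hy]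
        ring_nf
        rw [mul_two, CharTwo.add_self_eq_zero, zero_add]
      rw [h3, parity_add]
      simp [parity]
    have h4 : pauliTensor F y * pauliTensor F g = -(pauliTensor F g * pauliTensor F y) := by
      rw [pauliTensor_mul, pauliTensor_mul, h2, neg_smul, add_comm]
    rw [mul_assoc, ← mul_neg, ← h4]
  have h2 := congrArg Matrix.trace h1
  rw [Matrix.trace_neg, Matrix.trace_mul_comm, self_eq_neg, mul_assoc] at h2
  have h3 : pauliTensor F y * (pauliTensor F g * pauliTensor F y) =
      -(parity F (pauliForm y y) • pauliTensor F g) := by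
    rw [← mul_assoc, ← neg_eq_iff_eq_neg, ← h1, ← mul_assoc, pauliTensor_mul,
      add_self_pauliGroupZero, pauliTensor_zero, smul_mul_assoc, one_mul]
  rw [h3, Matrix.trace_neg, Matrix.trace_smul, neg_eq_zero, smul_eq_mul, mul_eq_zero] at h2
  exact h2.resolve_left (parity_ne_zero F _)

end PauliTensor

/-! ### A homogeneous basis of `P(2^q)` -/

section PauliBasis

variable (F : Type*) [Field F] {q : ℕ}

/-- The spanning element of the homogeneous component of degree `x` of `P(2^q)`, as a matrix. -/
noncomputable def pauliBasisMatrix (x : PauliGroup q) :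
    Matrix ((Fin q → Fin 2) ⊕ (Fin q → Fin 2)) ((Fin q → Fin 2) ⊕ (Fin q → Fin 2)) F :=
  if x.1 = 0 then
    if x.2 = 0 then 0 else fromBlocks (pauliTensor F x.2) 0 0 (-(pauliTensor F x.2)ᵀ)
  else if pauliForm x.2 x.2 = 0 then fromBlocks 0 (pauliTensor F x.2) 0 0
  else fromBlocks 0 0 (pauliTensor F x.2) 0

variable {F} in
theorem transpose_pauliTensor_of_form_eq_zero {g : PauliGroupZero q} (hg : pauliForm g g = 0) :
    (pauliTensor F g)ᵀ = pauliTensor F g := by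
  rw [pauliTensor_transpose, hg]
  simp [parity]

variable {F} in
theorem transpose_pauliTensor_of_form_ne_zero {g : PauliGroupZero q} (hg : pauliForm g g ≠ 0) :
    (pauliTensor F g)ᵀ = -pauliTensor F g := by
  rw [pauliTensor_transpose]
  simp [parity, hg]

variable [CharZero F]

theorem pauliBasisMatrix_mem (x : PauliGroup q) :
    pauliBasisMatrix F x ∈ superPSubmodule F (Fin q → Fin 2) := by
  unfold pauliBasisMatrix
  split_ifs with h1 h2 h3
  · exact Submodule.zero_mem _
  · exact ⟨pauliTensor F x.2, 0, 0, trace_pauliTensor F h2, by simp, by simp, rfl⟩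
  · exact ⟨0, pauliTensor F x.2, 0, by simp, transpose_pauliTensor_of_form_eq_zero h3, by simp,
      by simp⟩
  · exact ⟨0, 0, pauliTensor F x.2, by simp, by simp, transpose_pauliTensor_of_form_ne_zero h3,
      by simp⟩

/-- The spanning element of the homogeneous component of degree `x` of `P(2^q)`. -/
noncomputable def pauliBasis (x : PauliGroup q) : SuperP F (Fin q → Fin 2) :=
  ⟨pauliBasisMatrix F x, pauliBasisMatrix_mem F x⟩

theorem pauliBasis_zero : pauliBasis F ((0, 0) : PauliGroup q) = 0 := by
  apply Subtype.ext
  simp [pauliBasis, pauliBasisMatrix]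

variable {F}

theorem matrix_eq_zero_of_eq_neg {ι : Type*} {X : Matrix ι ι F} (h : X = -X) : X = 0 := by
  ext i j
  have := congrFun (congrFun h i) j
  rwa [neg_apply, self_eq_neg] at this

theorem coe_pauliBasis_even {g : PauliGroupZero q} (hg : g ≠ 0) :
    (pauliBasis F (0, g)).1 = fromBlocks (pauliTensor F g) 0 0 (-(pauliTensor F g)ᵀ) := by
  simp [pauliBasis, pauliBasisMatrix, hg]

theorem coe_pauliBasis_symm {g : PauliGroupZero q} (hg : pauliForm g g = 0) :
    (pauliBasis F (1, g)).1 = fromBlocks 0 (pauliTensor F g) 0 0 := by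
  simp [pauliBasis, pauliBasisMatrix, hg]

theorem coe_pauliBasis_skew {g : PauliGroupZero q} (hg : pauliForm g g ≠ 0) :
    (pauliBasis F (1, g)).1 = fromBlocks 0 0 (pauliTensor F g) 0 := by
  simp [pauliBasis, pauliBasisMatrix, hg]

theorem pauliBasis_even_ne_zero {g : PauliGroupZero q} (hg : g ≠ 0) :
    pauliBasis F (0, g) ≠ 0 := by
  intro h
  have h1 := congrArg Subtype.val h
  rw [coe_pauliBasis_even hg] at h1
  have h2 := congrArg toBlocks₁₁ h1
  rw [toBlocks_fromBlocks₁₁] at h2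
  exact pauliTensor_ne_zero F g h2

/-- Each T_g is symmetric or skew, so in odd degree only one of the two blocks can be occupied; the
other alternative forces X = -X. -/
theorem pauliGrading_eq_span (x : PauliGroup q) :
    pauliGrading F q x = Submodule.span F {pauliBasis F x} := by
  obtain ⟨a, g⟩ := x
  have hself : pauliTensor F g ∈ pauliMatrixComponent F g := Submodule.mem_span_singleton_self _
  rcases zmod_two_eq_zero_or_one a with rfl | rfl
  · rw [pauliGrading, if_pos rfl]
    refine le_antisymm ?_ ?_
    · rw [Submodule.span_le]
      rintro Y ⟨X, hX, htr, hY⟩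
      obtain ⟨c, rfl⟩ := Submodule.mem_span_singleton.mp hX
      by_cases hg : g = 0
      · subst hg
        rw [trace_smul, pauliTensor_zero, trace_one, smul_eq_mul, mul_eq_zero] at htr
        have hc : c = 0 := htr.resolve_right (by simp)
        have : Y = 0 := by
          apply Subtype.ext
          rw [hY, hc]
          simp
        rw [this]
        exact Submodule.zero_mem _
      · refine Submodule.mem_span_singleton.mpr ⟨c, Subtype.ext ?_⟩
        rw [hY, SetLike.val_smul, coe_pauliBasis_even hg, fromBlocks_smul]
        simp
    · rw [Submodule.span_singleton_le_iff_mem]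
      by_cases hg : g = 0
      · subst hg
        rw [pauliBasis_zero]
        exact Submodule.zero_mem _
      · exact Submodule.subset_span
          ⟨pauliTensor F g, hself, trace_pauliTensor F hg, coe_pauliBasis_even hg⟩
  · rw [pauliGrading, if_neg one_ne_zero]
    by_cases hg : pauliForm g g = 0
    · have hT := transpose_pauliTensor_of_form_eq_zero (F := F) hg
      refine le_antisymm ?_ ?_
      · rw [Submodule.span_le]
        rintro Y ⟨X, hX, h⟩
        obtain ⟨c, rfl⟩ := Submodule.mem_span_singleton.mp hX
        rcases h with ⟨-, hY⟩ | ⟨hX', hY⟩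
        · refine Submodule.mem_span_singleton.mpr ⟨c, Subtype.ext ?_⟩
          rw [hY, SetLike.val_smul, coe_pauliBasis_symm hg, fromBlocks_smul]
          simp
        · rw [transpose_smul, hT] at hX'
          replace hX' := matrix_eq_zero_of_eq_neg hX'
          have : Y = 0 := by
            apply Subtype.ext
            rw [hY]
            simp only at hX' ⊢
            rw [hX']
            simp
          rw [this]
          exact Submodule.zero_mem _
      · rw [Submodule.span_singleton_le_iff_mem]
        exact Submodule.subset_span
          ⟨pauliTensor F g, hself, Or.inl ⟨hT, coe_pauliBasis_symm hg⟩⟩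
    · have hT := transpose_pauliTensor_of_form_ne_zero (F := F) hg
      refine le_antisymm ?_ ?_
      · rw [Submodule.span_le]
        rintro Y ⟨X, hX, h⟩
        obtain ⟨c, rfl⟩ := Submodule.mem_span_singleton.mp hX
        rcases h with ⟨hX', hY⟩ | ⟨-, hY⟩
        · rw [transpose_smul, hT, smul_neg] at hX'
          replace hX' := matrix_eq_zero_of_eq_neg hX'.symm
          have : Y = 0 := by
            apply Subtype.ext
            rw [hY]
            simp only at hX' ⊢
            rw [hX']
            simp
          rw [this]
          exact Submodule.zero_mem _
        · refine Submodule.mem_span_singleton.mpr ⟨c, Subtype.ext ?_⟩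
          rw [hY, SetLike.val_smul, coe_pauliBasis_skew hg, fromBlocks_smul]
          simp
      · rw [Submodule.span_singleton_le_iff_mem]
        exact Submodule.subset_span
          ⟨pauliTensor F g, hself, Or.inr ⟨hT, coe_pauliBasis_skew hg⟩⟩

/-! ### Multiplication table of the homogeneous basis -/

theorem pauliBasis_even_mul_even (g h : PauliGroupZero q) :
    pauliBasis F (0, g) * pauliBasis F (0, h) =
      (parity F (pauliForm g h) - parity F (pauliForm h g)) • pauliBasis F (0, g + h) := by
  by_cases hg : g = 0
  · subst hg
    simp [pauliBasis_zero, pauliForm]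
  by_cases hh : h = 0
  · subst hh
    simp [pauliBasis_zero, pauliForm]
  by_cases hgh : g = h
  · subst hgh
    apply Subtype.ext
    rw [SuperP.coe_mul, coe_pauliBasis_even hg, superBracket_fromBlocks]
    simp
  · have hsum : g + h ≠ 0 := by
      intro h0
      apply hgh
      rw [← add_zero g, ← add_self_pauliGroupZero h, ← add_assoc, h0, zero_add]
    apply Subtype.ext
    rw [SuperP.coe_mul, SetLike.val_smul, coe_pauliBasis_even hg, coe_pauliBasis_even hh,
      coe_pauliBasis_even hsum, superBracket_fromBlocks, fromBlocks_smul]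
    have h1 := pauliTensor_mul F g h
    have h2 := pauliTensor_mul F h g
    rw [add_comm h g] at h2
    congr 1
    · simp [h1, h2, sub_smul]
    · simp
    · simp
    · simp only [neg_mul_neg, ← transpose_mul, h1, h2]
      simp [sub_smul]

theorem pauliBasis_even_mul_symm {g h : PauliGroupZero q} (hg : g ≠ 0)
    (hh : pauliForm h h = 0) :
    (pauliBasis F (0, g) * pauliBasis F (1, h)).1 =
      fromBlocks 0 (parity F (pauliForm g h) •
        (pauliTensor F (g + h) + (pauliTensor F (g + h))ᵀ)) 0 0 := by
  rw [SuperP.coe_mul, coe_pauliBasis_even hg, coe_pauliBasis_symm hh, superBracket_fromBlocks]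
  have h1 := pauliTensor_mul F g h
  have h2 := congrArg transpose h1
  rw [transpose_mul, transpose_pauliTensor_of_form_eq_zero hh, transpose_smul] at h2
  congr 1
  · simp
  · simp [h1, h2]
  · simp
  · simp

theorem pauliBasis_even_mul_skew {g h : PauliGroupZero q} (hg : g ≠ 0)
    (hh : pauliForm h h ≠ 0) :
    (pauliBasis F (0, g) * pauliBasis F (1, h)).1 =
      fromBlocks 0 0 (parity F (pauliForm h g) •
        ((pauliTensor F (g + h))ᵀ - pauliTensor F (g + h))) 0 := by
  rw [SuperP.coe_mul, coe_pauliBasis_even hg, coe_pauliBasis_skew hh, superBracket_fromBlocks]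
  have h1 := pauliTensor_mul F h g
  have h2 := congrArg transpose h1
  rw [transpose_mul, transpose_pauliTensor_of_form_ne_zero hh, transpose_smul, mul_neg] at h2
  rw [add_comm h g] at h1 h2
  congr 1
  · simp
  · simp
  · simp [h1, h2, smul_sub]
  · simp

theorem pauliBasis_symm_mul_skew {g h : PauliGroupZero q} (hg : pauliForm g g = 0)
    (hh : pauliForm h h ≠ 0) :
    pauliBasis F (1, g) * pauliBasis F (1, h) =
      parity F (pauliForm g h) • pauliBasis F (0, g + h) := by
  have hsum : g + h ≠ 0 := by
    intro h0
    apply hh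
    rwa [← zero_add h, ← add_self_pauliGroupZero g, add_assoc, h0, add_zero]
  apply Subtype.ext
  rw [SuperP.coe_mul, SetLike.val_smul, coe_pauliBasis_symm hg, coe_pauliBasis_skew hh,
    coe_pauliBasis_even hsum, superBracket_fromBlocks, fromBlocks_smul]
  have h1 := pauliTensor_mul F g h
  have h2 := congrArg transpose h1
  rw [transpose_mul, transpose_pauliTensor_of_form_ne_zero hh,
    transpose_pauliTensor_of_form_eq_zero hg, transpose_smul, neg_mul, neg_eq_iff_eq_neg] at h2
  congr 1
  · simp [h1]
  · simp
  · simp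
  · simp [h2]

theorem pauliBasis_odd_mul_odd_comm (g h : PauliGroupZero q) :
    pauliBasis F (1, g) * pauliBasis F (1, h) = pauliBasis F (1, h) * pauliBasis F (1, g) := by
  apply Subtype.ext
  rw [SuperP.coe_mul, SuperP.coe_mul]
  by_cases hg : pauliForm g g = 0 <;> by_cases hh : pauliForm h h = 0
  · rw [coe_pauliBasis_symm hg, coe_pauliBasis_symm hh, superBracket_fromBlocks,
      superBracket_fromBlocks]
    simp
  · rw [coe_pauliBasis_symm hg, coe_pauliBasis_skew hh, superBracket_fromBlocks,
      superBracket_fromBlocks]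
    simp
  · rw [coe_pauliBasis_skew hg, coe_pauliBasis_symm hh, superBracket_fromBlocks,
      superBracket_fromBlocks]
    simp
  · rw [coe_pauliBasis_skew hg, coe_pauliBasis_skew hh, superBracket_fromBlocks,
      superBracket_fromBlocks]
    simp

theorem pauliBasis_odd_mul_even (g h : PauliGroupZero q) :
    pauliBasis F (1, h) * pauliBasis F (0, g) =
      -(pauliBasis F (0, g) * pauliBasis F (1, h)) := by
  by_cases hg : g = 0
  · subst hg
    simp [pauliBasis_zero]
  apply Subtype.ext
  rw [NegMemClass.coe_neg, SuperP.coe_mul, SuperP.coe_mul]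
  by_cases hh : pauliForm h h = 0
  · rw [coe_pauliBasis_even hg, coe_pauliBasis_symm hh, superBracket_fromBlocks,
      superBracket_fromBlocks, fromBlocks_neg]
    simp [sub_eq_add_neg, add_comm]
  · rw [coe_pauliBasis_even hg, coe_pauliBasis_skew hh, superBracket_fromBlocks,
      superBracket_fromBlocks, fromBlocks_neg]
    simp [sub_eq_add_neg, add_comm]

/-- The degree of `pauliBasis F x` in the grading of `P(t)` by `{-1, 0, 1}`. -/
def pauliWeight (x : PauliGroup q) : ℤ :=
  if x.1 = 0 then 0 else if pauliForm x.2 x.2 = 0 then 1 else -1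

/-- The product is a block ±(X + Xᵀ) or ±(Xᵀ - X) with X = T_{g+h}. It vanishes exactly when T_{g+h}
and T_h differ in symmetry type, which is when the weight would change. -/
theorem pauliBasis_even_mul_odd (g h : PauliGroupZero q) :
    ∃ c : F, pauliBasis F (0, g) * pauliBasis F (1, h) = c • pauliBasis F (1, g + h) ∧
      (c ≠ 0 → pauliWeight ((1, g + h) : PauliGroup q) = pauliWeight ((1, h) : PauliGroup q)) := by
  by_cases hg : g = 0
  · subst hg
    exact ⟨0, by rw [pauliBasis_zero, zero_mul, zero_smul], fun h => absurd rfl h⟩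
  by_cases hh : pauliForm h h = 0
  · by_cases hs : pauliForm (g + h) (g + h) = 0
    · refine ⟨parity F (pauliForm g h) * 2, Subtype.ext ?_, fun _ => by simp [pauliWeight, hh, hs]⟩
      rw [pauliBasis_even_mul_symm hg hh, SetLike.val_smul, coe_pauliBasis_symm hs,
        transpose_pauliTensor_of_form_eq_zero hs, fromBlocks_smul]
      congr 1 <;> module
    · refine ⟨0, Subtype.ext ?_, fun h => absurd rfl h⟩
      rw [pauliBasis_even_mul_symm hg hh, transpose_pauliTensor_of_form_ne_zero hs]
      simp
  · by_cases hs : pauliForm (g + h) (g + h) = 0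
    · refine ⟨0, Subtype.ext ?_, fun h => absurd rfl h⟩
      rw [pauliBasis_even_mul_skew hg hh, transpose_pauliTensor_of_form_eq_zero hs]
      simp
    · refine ⟨parity F (pauliForm h g) * (-2), Subtype.ext ?_,
        fun _ => by simp [pauliWeight, hh, hs]⟩
      rw [pauliBasis_even_mul_skew hg hh, SetLike.val_smul, coe_pauliBasis_skew hs,
        transpose_pauliTensor_of_form_ne_zero hs, fromBlocks_smul]
      congr 1 <;> module

theorem pauliBasis_mul (x y : PauliGroup q) :
    ∃ c : F, pauliBasis F x * pauliBasis F y = c • pauliBasis F (x + y) ∧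
      (c ≠ 0 → pauliWeight (x + y) = pauliWeight x + pauliWeight y) := by
  obtain ⟨a, g⟩ := x
  obtain ⟨b, h⟩ := y
  have h11 : (1 : ZMod 2) + 1 = 0 := rfl
  rcases zmod_two_eq_zero_or_one a with rfl | rfl <;>
    rcases zmod_two_eq_zero_or_one b with rfl | rfl
  · rw [Prod.mk_add_mk, add_zero]
    exact ⟨_, pauliBasis_even_mul_even g h, fun _ => by simp [pauliWeight]⟩
  · rw [Prod.mk_add_mk, zero_add]
    obtain ⟨c, hc, hw⟩ := pauliBasis_even_mul_odd (F := F) g h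
    exact ⟨c, hc, fun h0 => by rw [hw h0]; simp [pauliWeight]⟩
  · rw [Prod.mk_add_mk, add_zero, pauliBasis_odd_mul_even, add_comm g h]
    obtain ⟨c, hc, hw⟩ := pauliBasis_even_mul_odd (F := F) h g
    refine ⟨-c, by rw [hc, neg_smul], fun h0 => ?_⟩
    rw [hw (neg_ne_zero.mp h0)]
    simp [pauliWeight]
  · rw [Prod.mk_add_mk, h11]
    by_cases hg : pauliForm g g = 0 <;> by_cases hh : pauliForm h h = 0
    · refine ⟨0, Subtype.ext ?_, fun h0 => absurd rfl h0⟩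
      rw [SuperP.coe_mul, coe_pauliBasis_symm hg, coe_pauliBasis_symm hh, superBracket_fromBlocks]
      simp
    · exact ⟨_, pauliBasis_symm_mul_skew hg hh, fun _ => by simp [pauliWeight, hg, hh]⟩
    · rw [pauliBasis_odd_mul_odd_comm, add_comm g h]
      exact ⟨_, pauliBasis_symm_mul_skew hh hg, fun _ => by simp [pauliWeight, hg, hh]⟩
    · refine ⟨0, Subtype.ext ?_, fun h0 => absurd rfl h0⟩
      rw [SuperP.coe_mul, coe_pauliBasis_skew hg, coe_pauliBasis_skew hh, superBracket_fromBlocks]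
      simp

end PauliBasis

/-! ### Nonzero monomials of almost every balanced type -/

section Absorption

theorem exists_eq_add_ite_of_sum_eq_succ {γ : Type*} [DecidableEq γ] (U : Finset γ) (c : γ → ℕ)
    (M : ℕ) (hc : ∑ x ∈ U, c x = M + 1) : ∃ g ∈ U, ∃ c' : γ → ℕ, ∑ x ∈ U, c' x = M ∧
      ∀ x, c x = c' x + if x = g then 1 else 0 := by
  obtain ⟨g, hg, hg0⟩ := Finset.exists_ne_zero_of_sum_ne_zero (by omega : ∑ x ∈ U, c x ≠ 0)
  have h1 : ∀ x, c x = (c x - if x = g then 1 else 0) + if x = g then 1 else 0 := by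
    intro x
    split_ifs with h
    · subst h
      omega
    · rfl
  refine ⟨g, hg, fun x => c x - if x = g then 1 else 0, ?_, h1⟩
  rw [Finset.sum_congr rfl fun x _ => h1 x, Finset.sum_add_distrib, Finset.sum_ite_eq',
    if_pos hg] at hc
  exact Nat.succ_injective hc

/-- A transport matrix with prescribed row and column sums, built one unit at a time. It records how
many times each symmetric degree is paired with each skew degree. -/
theorem exists_sum_eq_sum_eq {α β : Type*} [DecidableEq α] [DecidableEq β] (S : Finset α)
    (T : Finset β) (N : ℕ) : ∀ (a : α → ℕ) (b : β → ℕ), ∑ x ∈ S, a x = N → ∑ y ∈ T, b y = N →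
      ∃ m : α → β → ℕ, (∀ x ∈ S, ∑ y ∈ T, m x y = a x) ∧ ∀ y ∈ T, ∑ x ∈ S, m x y = b y := by
  induction N with
  | zero =>
    intro a b ha hb
    refine ⟨0, fun x hx => ?_, fun y hy => ?_⟩
    · simp [Finset.sum_eq_zero_iff.mp ha x hx]
    · simp [Finset.sum_eq_zero_iff.mp hb y hy]
  | succ N ih =>
    intro a b ha hb
    obtain ⟨g, hg, a', ha', haa'⟩ := exists_eq_add_ite_of_sum_eq_succ S a N ha
    obtain ⟨h, hh, b', hb', hbb'⟩ := exists_eq_add_ite_of_sum_eq_succ T b N hb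
    obtain ⟨m, hma, hmb⟩ := ih a' b' ha' hb'
    refine ⟨fun x y => m x y + if x = g then (if y = h then 1 else 0) else 0,
      fun x hx => ?_, fun y hy => ?_⟩
    · rw [Finset.sum_add_distrib, hma x hx, haa']
      split_ifs
      · rw [Finset.sum_ite_eq', if_pos hh]
      · simp
    · rw [Finset.sum_add_distrib, hmb y hy, hbb', Finset.sum_ite_eq', if_pos hg]

variable {F : Type*} [Field F] [CharZero F] {q : ℕ}

theorem parity_sub_parity_ne_zero {a b : ZMod 2} (h : a + b = 1) :
    parity F a - parity F b ≠ 0 := by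
  rcases zmod_two_eq_zero_or_one a with rfl | rfl
  · rw [zero_add] at h
    subst h
    simp [parity]
  · have : b = 0 := by simpa using h
    subst this
    simp [parity, ← neg_add']

theorem IsRealized.even_mul_even {n m : PauliGroup q → ℕ} {x g : PauliGroupZero q}
    (hn : IsRealized F (pauliBasis F) n (0, x)) (hm : IsRealized F (pauliBasis F) m (0, g))
    (hxg : pauliForm x g + pauliForm g x = 1) :
    IsRealized F (pauliBasis F) (n + m) (0, x + g) :=
  hn.mul hm ⟨_, parity_sub_parity_ne_zero hxg, pauliBasis_even_mul_even x g⟩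

theorem pauliForm_add_self_left {x g : PauliGroupZero q} :
    pauliForm (x + g) g + pauliForm g (x + g) = pauliForm x g + pauliForm g x := by
  rw [pauliForm_add_left, pauliForm_add_right, add_add_add_comm, CharTwo.add_self_eq_zero,
    add_zero]

theorem add_add_self_pauliGroupZero (x g : PauliGroupZero q) : x + g + g = x := by
  rw [add_assoc, add_self_pauliGroupZero, add_zero]

/-- Multiplying twice by degree d leads from y to y + d and back to y; y + d still anticommutes with
d, so both products are nonzero. -/
theorem IsRealized.add_two_mul {n u : PauliGroup q → ℕ} {y d : PauliGroupZero q}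
    (hn : IsRealized F (pauliBasis F) n (0, y)) (hu : IsRealized F (pauliBasis F) u (0, d))
    (hyd : pauliForm y d + pauliForm d y = 1) (k : ℕ) :
    IsRealized F (pauliBasis F) (n + (2 * k) • u) (0, y) := by
  induction k with
  | zero => simpa using hn
  | succ k ih =>
    have h1 := (ih.even_mul_even hu hyd).even_mul_even hu (pauliForm_add_self_left.trans hyd)
    rw [add_add_self_pauliGroupZero] at h1
    convert! h1 using 1
    rw [mul_add, add_smul, mul_one, two_smul, ← add_assoc, ← add_assoc]

theorem IsRealized.exists_add_nsmul {n u : PauliGroup q → ℕ} {x d : PauliGroupZero q}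
    (hx : x ≠ 0) (hd : d ≠ 0) (hn : IsRealized F (pauliBasis F) n (0, x))
    (hu : IsRealized F (pauliBasis F) u (0, d)) (hu2 : ∑ g, u g ≤ 2) (m : ℕ) :
    ∃ e : PauliGroup q → ℕ, ∑ g, e g ≤ 4 ∧ IsRealized F (pauliBasis F) (n + m • u + e) (0, x) := by
  obtain ⟨y, hyx, hyd⟩ := exists_pauliForm_add_eq_one_both hx hd
  -- One variable of degree x + y moves x to y, where copies of d can be absorbed; a second one
  -- moves y back to x.
  have hp := IsRealized.single (F := F) (pauliBasis F) ((0, x + y) : PauliGroup q)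
  have hform : pauliForm x (x + y) + pauliForm (x + y) x = 1 := by
    rw [add_comm x y, add_comm (pauliForm x _), pauliForm_add_self_left, hyx]
  have hform' : pauliForm y (x + y) + pauliForm (x + y) y = 1 := by
    rw [add_comm (pauliForm y _), pauliForm_add_self_left, add_comm, hyx]
  have h1 := hn.even_mul_even hp hform
  rw [← add_assoc, add_self_pauliGroupZero, zero_add] at h1
  have h2 := (h1.add_two_mul hu hyd ((m + 1) / 2)).even_mul_even hp hform'
  rw [add_comm x y, ← add_assoc, add_self_pauliGroupZero, zero_add] at h2
  -- Two moving variables, and one more copy of u when m is odd: at most 2 + 2 variables.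
  refine ⟨2 • Pi.single (0, y + x) 1 + (m % 2) • u, ?_, ?_⟩
  · simp only [Pi.add_apply, Pi.smul_apply, smul_eq_mul, Finset.sum_add_distrib, ← Finset.mul_sum,
      Finset.sum_pi_single', Finset.mem_univ, if_true]
    have := Nat.mul_le_mul (show m % 2 ≤ 1 by omega) hu2
    omega
  · convert! h2 using 1
    have hm : 2 * ((m + 1) / 2) = m + m % 2 := by omega
    rw [hm, add_smul, two_smul]
    abel

theorem IsRealized.exists_add_sum_nsmul {τ : Type*} (T : Finset τ) (u : τ → PauliGroup q → ℕ)
    (d : τ → PauliGroupZero q) (hd : ∀ i ∈ T, d i ≠ 0)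
    (hu : ∀ i ∈ T, IsRealized F (pauliBasis F) (u i) (0, d i)) (hu2 : ∀ i ∈ T, ∑ g, u i g ≤ 2)
    (m : τ → ℕ) {n : PauliGroup q → ℕ} {x : PauliGroupZero q} (hx : x ≠ 0)
    (hn : IsRealized F (pauliBasis F) n (0, x)) :
    ∃ e : PauliGroup q → ℕ, ∑ g, e g ≤ 4 * T.card ∧
      IsRealized F (pauliBasis F) (n + ∑ i ∈ T, m i • u i + e) (0, x) := by
  classical
  induction T using Finset.induction_on with
  | empty => exact ⟨0, by simp, by simpa using hn⟩
  | insert i T hi ih =>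
    obtain ⟨e, he, hre⟩ := ih (fun j hj => hd j (Finset.mem_insert_of_mem hj))
      (fun j hj => hu j (Finset.mem_insert_of_mem hj))
      (fun j hj => hu2 j (Finset.mem_insert_of_mem hj))
    obtain ⟨e', he', hre'⟩ := hre.exists_add_nsmul hx (hd i (Finset.mem_insert_self i T))
      (hu i (Finset.mem_insert_self i T)) (hu2 i (Finset.mem_insert_self i T)) (m i)
    refine ⟨e + e', ?_, ?_⟩
    · simp only [Pi.add_apply, Finset.sum_add_distrib, Finset.card_insert_of_notMem hi]
      omega
    · convert! hre' using 1
      rw [Finset.sum_insert hi]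
      abel

/-- Padding to an exact length. Repeated multiplication by a degree p anticommuting with x never
gives zero, as each new degree still anticommutes with p. -/
theorem IsRealized.exists_add_of_sum_eq {n : PauliGroup q → ℕ} {x : PauliGroupZero q} (hx : x ≠ 0)
    (hn : IsRealized F (pauliBasis F) n (0, x)) (j : ℕ) :
    ∃ e : PauliGroup q → ℕ, ∑ g, e g = j ∧
      ∃ y : PauliGroupZero q, y ≠ 0 ∧ IsRealized F (pauliBasis F) (n + e) (0, y) := by
  obtain ⟨p, hp⟩ := exists_pauliForm_add_eq_one hx
  have key : ∀ j : ℕ, ∃ y, pauliForm y p + pauliForm p y = 1 ∧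
      IsRealized F (pauliBasis F) (n + j • Pi.single ((0, p) : PauliGroup q) 1) (0, y) := by
    intro j
    induction j with
    | zero => exact ⟨x, by rwa [add_comm], by simpa using hn⟩
    | succ j ih =>
      obtain ⟨y, hy, hr⟩ := ih
      refine ⟨y + p, pauliForm_add_self_left.trans hy, ?_⟩
      rw [succ_nsmul, ← add_assoc]
      exact hr.even_mul_even (IsRealized.single _ _) hy
  obtain ⟨y, hy, hr⟩ := key j
  refine ⟨_, ?_, y, ?_, hr⟩
  · simp [← Finset.mul_sum]
  · rintro rfl
    simp [pauliForm] at hy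

/-- The degrees `(1, g)` with `T_g` symmetric, as elements of `G₀`. -/
def symmDegrees (q : ℕ) : Finset (PauliGroupZero q) :=
  Finset.univ.filter fun g => pauliForm g g = 0

/-- The degrees `(1, g)` with `T_g` skew-symmetric, as elements of `G₀`. -/
def skewDegrees (q : ℕ) : Finset (PauliGroupZero q) :=
  Finset.univ.filter fun g => pauliForm g g ≠ 0

theorem sum_zmod_two {M : Type*} [AddCommMonoid M] (f : ZMod 2 → M) : ∑ a, f a = f 0 + f 1 :=
  Fin.sum_univ_two f

theorem sum_pauliGroup {M : Type*} [AddCommMonoid M] (f : PauliGroup q → M) :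
    ∑ x, f x = ∑ g, f (0, g) + (∑ g ∈ symmDegrees q, f (1, g) + ∑ g ∈ skewDegrees q, f (1, g)) := by
  rw [Fintype.sum_prod_type, symmDegrees, skewDegrees, Finset.sum_filter_add_sum_filter_not,
    sum_zmod_two]

theorem exists_eq_sum_of_mem_balancedTypes {N : ℕ} {n : PauliGroup q → ℕ}
    (hn : n ∈ balancedTypes (Finset.univ.erase 0) pauliWeight N) :
    ∃ m : PauliGroupZero q × PauliGroupZero q → ℕ,
      n = ∑ g ∈ Finset.univ.erase 0, n (0, g) • Pi.single ((0, g) : PauliGroup q) 1 +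
        ∑ p ∈ symmDegrees q ×ˢ skewDegrees q,
          m p • (Pi.single ((1, p.1) : PauliGroup q) 1 + Pi.single ((1, p.2) : PauliGroup q) 1) := by
  obtain ⟨hsupp, hbal⟩ := (Finset.mem_filter.mp hn).2
  rw [sum_pauliGroup] at hbal
  have hsymm : ∀ g ∈ symmDegrees q, pauliForm g g = 0 := fun g hg => (Finset.mem_filter.mp hg).2
  have hskew : ∀ g ∈ skewDegrees q, pauliForm g g ≠ 0 := fun g hg => (Finset.mem_filter.mp hg).2
  have h0 : ∀ g ∈ Finset.univ, (n (0, g) : ℤ) * pauliWeight ((0, g) : PauliGroup q) = 0 :=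
    fun g _ => by simp [pauliWeight]
  have h1 : ∀ g ∈ symmDegrees q, (n (1, g) : ℤ) * pauliWeight ((1, g) : PauliGroup q) = n (1, g) :=
    fun g hg => by simp [pauliWeight, hsymm g hg]
  have h2 : ∀ g ∈ skewDegrees q, (n (1, g) : ℤ) * pauliWeight ((1, g) : PauliGroup q) =
      -n (1, g) := fun g hg => by simp [pauliWeight, hskew g hg]
  rw [Finset.sum_congr rfl h0, Finset.sum_congr rfl h1, Finset.sum_congr rfl h2,
    Finset.sum_const_zero, zero_add, Finset.sum_neg_distrib, ← sub_eq_add_neg, sub_eq_zero] at hbal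
  obtain ⟨m, hm1, hm2⟩ := exists_sum_eq_sum_eq (symmDegrees q) (skewDegrees q) _
    (fun g => n (1, g)) (fun g => n (1, g)) rfl (by exact_mod_cast hbal.symm)
  refine ⟨fun p => m p.1 p.2, ?_⟩
  funext x
  obtain ⟨a, g⟩ := x
  simp only [Pi.add_apply, Finset.sum_apply, Pi.smul_apply, smul_eq_mul]
  rcases zmod_two_eq_zero_or_one a with rfl | rfl
  · rw [Finset.sum_eq_zero (s := symmDegrees q ×ˢ skewDegrees q)
      (fun p _ => by simp), add_zero]
    by_cases hg : g = 0
    · subst hg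
      rw [Finset.sum_eq_zero]
      · exact hsupp 0 (Finset.notMem_erase 0 _)
      intro h hh
      simp [(Finset.ne_of_mem_erase hh).symm]
    · rw [Finset.sum_eq_single_of_mem g (Finset.mem_erase.mpr ⟨hg, Finset.mem_univ g⟩)]
      · simp
      · intro h _ hh
        simp [hh.symm]
  · rw [Finset.sum_eq_zero (s := Finset.univ.erase 0) (fun p _ => by simp),
      zero_add]
    simp only [mul_add, Finset.sum_add_distrib, Pi.single_apply, Prod.mk.injEq, true_and,
      mul_ite, mul_one, mul_zero]
    rw [Finset.sum_product, Finset.sum_product_right]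
    simp only [Finset.sum_ite_irrel, Finset.sum_const_zero, Finset.sum_ite_eq]
    by_cases hg : pauliForm g g = 0
    · have hg1 : g ∈ symmDegrees q := Finset.mem_filter.mpr ⟨Finset.mem_univ g, hg⟩
      have hg2 : g ∉ skewDegrees q := fun h => hskew g h hg
      rw [if_pos hg1, if_neg hg2, add_zero, hm1 g hg1]
    · have hg1 : g ∉ symmDegrees q := fun h => hg (hsymm g h)
      have hg2 : g ∈ skewDegrees q := Finset.mem_filter.mpr ⟨Finset.mem_univ g, hg⟩
      rw [if_neg hg1, if_pos hg2, zero_add, hm2 g hg2]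

theorem exists_add_partialCodimension_ne_zero (F : Type*) [Field F] [CharZero F] {q : ℕ}
    (hq : 1 ≤ q) : ∃ K : ℕ, ∀ N, ∀ n ∈ balancedTypes (Finset.univ.erase 0) pauliWeight N,
      ∃ d : PauliGroup q → ℕ, ∑ g, d g = K ∧
        partialCodimension F (pauliGrading F q) (n + d) ≠ 0 := by
  obtain ⟨x, hx⟩ : ∃ x : PauliGroupZero q, x ≠ 0 :=
    ⟨Pi.single ⟨0, hq⟩ (1, 0), fun h => by simp at h⟩
  have hsymm : ∀ g ∈ symmDegrees q, pauliForm g g = 0 := fun g hg => (Finset.mem_filter.mp hg).2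
  have hskew : ∀ g ∈ skewDegrees q, pauliForm g g ≠ 0 := fun g hg => (Finset.mem_filter.mp hg).2
  -- One starting variable of degree x, then at most 4 auxiliary variables for each even degree and
  -- each symmetric-skew pair. The slack is filled at the end, so that K does not depend on n.
  refine ⟨1 + 4 * ((Finset.univ : Finset (PauliGroupZero q)).erase 0).card +
    4 * (symmDegrees q ×ˢ skewDegrees q).card, fun N n hn => ?_⟩
  obtain ⟨m, hm⟩ := exists_eq_sum_of_mem_balancedTypes hn
  have h0 := IsRealized.single (F := F) (pauliBasis F) ((0, x) : PauliGroup q)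
  obtain ⟨e₁, he₁, h1⟩ := h0.exists_add_sum_nsmul (Finset.univ.erase 0)
    (fun g => Pi.single ((0, g) : PauliGroup q) 1) (fun g => g)
    (fun g hg => Finset.ne_of_mem_erase hg) (fun g _ => IsRealized.single _ _)
    (fun g _ => by simp) (fun g => n (0, g)) hx
  obtain ⟨e₂, he₂, h2⟩ := h1.exists_add_sum_nsmul (symmDegrees q ×ˢ skewDegrees q)
    (fun p => Pi.single ((1, p.1) : PauliGroup q) 1 + Pi.single ((1, p.2) : PauliGroup q) 1)
    (fun p => p.1 + p.2)
    (fun p hp h => by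
      obtain ⟨hp1, hp2⟩ := Finset.mem_product.mp hp
      apply hskew _ hp2
      rw [← add_add_self_pauliGroupZero p.1 p.2, h, zero_add] at hp1
      exact hsymm _ hp1)
    (fun p hp => (IsRealized.single _ _).mul (IsRealized.single _ _)
      ⟨_, parity_ne_zero F _, pauliBasis_symm_mul_skew (hsymm _ (Finset.mem_product.mp hp).1)
        (hskew _ (Finset.mem_product.mp hp).2)⟩)
    (fun p _ => by simp [Finset.sum_add_distrib]) m hx
  obtain ⟨e₃, he₃, y, hy, h3⟩ := h2.exists_add_of_sum_eq hx
    (4 * ((Finset.univ : Finset (PauliGroupZero q)).erase 0).card +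
      4 * (symmDegrees q ×ˢ skewDegrees q).card - (∑ g, e₁ g + ∑ g, e₂ g))
  refine ⟨Pi.single (0, x) 1 + e₁ + e₂ + e₃, ?_, ?_⟩
  · simp only [Pi.add_apply, Finset.sum_add_distrib, Finset.sum_pi_single', Finset.mem_univ,
      if_true, he₃]
    omega
  · have h4 : n + (Pi.single (0, x) 1 + e₁ + e₂ + e₃) = Pi.single (0, x) 1 +
        ∑ g ∈ Finset.univ.erase 0, n (0, g) • Pi.single ((0, g) : PauliGroup q) 1 + e₁ +
        ∑ p ∈ symmDegrees q ×ˢ skewDegrees q, m p •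
          (Pi.single ((1, p.1) : PauliGroup q) 1 + Pi.single ((1, p.2) : PauliGroup q) 1) +
        e₂ + e₃ := by
      nth_rewrite 1 [hm]
      abel
    rw [h4, h3.partialCodimension_eq_one pauliGrading_eq_span
      (fun g h => (pauliBasis_mul g h).imp fun _ hc => hc.1) (pauliBasis_even_ne_zero hy)]
    exact one_ne_zero

end Absorption

/-! ### The graded PI-exponent -/

section Exponent

variable {q : ℕ}

theorem card_pauliGroupZero : Fintype.card (PauliGroupZero q) = (2 ^ q) ^ 2 := by
  rw [Fintype.card_fun, Fintype.card_prod, ZMod.card, Fintype.card_fin, mul_pow, ← pow_two]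

theorem card_symmDegrees_add : (symmDegrees q).card + (skewDegrees q).card = (2 ^ q) ^ 2 := by
  rw [← card_pauliGroupZero, symmDegrees, skewDegrees, Finset.card_filter_add_card_filter_not,
    Finset.card_univ]

/-- The sum of signs over G₀ factors over the tensor positions, each giving 1 + 1 + 1 - 1 = 2. -/
theorem card_symmDegrees_sub : ((symmDegrees q).card : ℝ) - (skewDegrees q).card = 2 ^ q := by
  have h1 : ∑ g : PauliGroupZero q, parity ℝ (pauliForm g g) = 2 ^ q := by
    have h2 := Finset.prod_univ_sum (fun _ : Fin q => (Finset.univ : Finset (ZMod 2 × ZMod 2)))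
      (fun _ u => parity ℝ (u.2 * u.1))
    rw [Fintype.piFinset_univ] at h2
    have h3 : ∑ u : ZMod 2 × ZMod 2, parity ℝ (u.2 * u.1) = 2 := by
      rw [Fintype.sum_prod_type, sum_zmod_two, sum_zmod_two, sum_zmod_two]
      simp [parity]
      norm_num
    simp only [pauliForm, parity_sum]
    rw [← h2, h3, Finset.prod_const, Finset.card_univ, Fintype.card_fin]
  rw [← h1, ← Finset.sum_filter_add_sum_filter_not Finset.univ (fun g => pauliForm g g = 0)]
  have h4 : ∀ g ∈ symmDegrees q, parity ℝ (pauliForm g g) = 1 := fun g hg => by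
    simp [parity, (Finset.mem_filter.mp hg).2]
  have h5 : ∀ g ∈ skewDegrees q, parity ℝ (pauliForm g g) = -1 := fun g hg => by
    simp [parity, (Finset.mem_filter.mp hg).2]
  rw [symmDegrees] at h4 ⊢
  rw [skewDegrees] at h5 ⊢
  rw [Finset.sum_congr rfl h4, Finset.sum_congr rfl h5]
  simp [sub_eq_add_neg]

theorem sum_erase_zero_pauliGroup {M : Type*} [AddCommMonoid M] (f : ℤ → M) :
    ∑ x ∈ (Finset.univ : Finset (PauliGroup q)).erase 0, f (pauliWeight x) =
      ((2 ^ q) ^ 2 - 1) • f 0 + ((symmDegrees q).card • f 1 + (skewDegrees q).card • f (-1)) := by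
  have h1 : ∑ x ∈ (Finset.univ : Finset (PauliGroup q)).erase 0, f (pauliWeight x) =
      ∑ x : PauliGroup q, if x = 0 then 0 else f (pauliWeight x) := by
    rw [Finset.sum_ite, Finset.sum_const_zero, zero_add]
    refine Finset.sum_congr ?_ fun _ _ => rfl
    ext x
    simp
  rw [h1, sum_pauliGroup]
  have h2 : ∑ g : PauliGroupZero q,
      (if ((0, g) : PauliGroup q) = 0 then 0 else f (pauliWeight ((0, g) : PauliGroup q))) =
      ((2 ^ q) ^ 2 - 1) • f 0 := by
    rw [← card_pauliGroupZero, ← Finset.card_univ,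
      ← Finset.card_erase_of_mem (Finset.mem_univ (0 : PauliGroupZero q)), ← Finset.sum_const]
    rw [← Finset.add_sum_erase _ _ (Finset.mem_univ (0 : PauliGroupZero q))]
    refine (congrArg₂ (· + ·) (if_pos rfl) (Finset.sum_congr rfl fun g hg => ?_)).trans (zero_add _)
    rw [if_neg (fun h => Finset.ne_of_mem_erase hg (congrArg Prod.snd h))]
    simp [pauliWeight]
  rw [h2, ← Finset.sum_const, ← Finset.sum_const]
  congr 2
  · refine Finset.sum_congr rfl fun g hg => ?_
    rw [if_neg (fun h => one_ne_zero (congrArg Prod.fst h))]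
    simp [pauliWeight, (Finset.mem_filter.mp hg).2]
  · refine Finset.sum_congr rfl fun g hg => ?_
    rw [if_neg (fun h => one_ne_zero (congrArg Prod.fst h))]
    simp [pauliWeight, (Finset.mem_filter.mp hg).2]

theorem card_filter_pauliWeight (k : ℤ) :
    (((Finset.univ : Finset (PauliGroup q)).erase 0).filter fun x => pauliWeight x = k).card =
      ((2 ^ q) ^ 2 - 1) • (if (0 : ℤ) = k then 1 else 0) +
        ((symmDegrees q).card • (if (1 : ℤ) = k then 1 else 0) +
          (skewDegrees q).card • (if (-1 : ℤ) = k then 1 else 0)) := by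
  rw [Finset.card_filter]
  exact sum_erase_zero_pauliGroup (fun z => if z = k then 1 else 0)

theorem pauliWeight_cases (x : PauliGroup q) :
    pauliWeight x = -1 ∨ pauliWeight x = 0 ∨ pauliWeight x = 1 := by
  unfold pauliWeight
  split_ifs <;> simp

end Exponent

theorem theorem1 (F : Type*) [Field F] [CharZero F] (q : ℕ) (hq : 1 ≤ q) :
    Tendsto (fun n : ℕ => (gradedCodimension F (pauliGrading F q) n : ℝ) ^ (1 / (n : ℝ))) atTop
      (𝓝 (((2 : ℝ) ^ q) ^ 2 - 1 + (2 : ℝ) ^ q * √(((2 : ℝ) ^ q) ^ 2 - 1))) := by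
  have ht2 : (2 : ℝ) ≤ 2 ^ q := le_self_pow₀ one_le_two (by omega)
  have hsub := card_symmDegrees_sub (q := q)
  have hadd : ((symmDegrees q).card : ℝ) + (skewDegrees q).card = (2 ^ q) ^ 2 := by
    exact_mod_cast card_symmDegrees_add (q := q)
  have hone : 1 ≤ (2 ^ q) ^ 2 := Nat.one_le_pow _ _ (by positivity)
  have hA : (((2 ^ q) ^ 2 - 1 : ℕ) : ℝ) = ((2 : ℝ) ^ q) ^ 2 - 1 := by
    rw [Nat.cast_sub hone]
    push_cast
    rfl
  set t : ℝ := 2 ^ q with ht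
  set b : ℝ := ((symmDegrees q).card : ℝ) with hb
  set c : ℝ := ((skewDegrees q).card : ℝ) with hc
  have hA0 : 0 < t ^ 2 - 1 := by nlinarith
  have hr2 : (t * √(t ^ 2 - 1)) ^ 2 = t ^ 2 * (t ^ 2 - 1) := by
    rw [mul_pow, Real.sq_sqrt hA0.le]
  have hr0 : 0 < t * √(t ^ 2 - 1) := mul_pos (by linarith) (Real.sqrt_pos.mpr hA0)
  set r : ℝ := t * √(t ^ 2 - 1) with hr
  have hbc : r ^ 2 = 4 * (b * c) := by
    rw [hr2]
    have h1 : b = (t ^ 2 + t) / 2 := by linarith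
    have h2 : c = (t ^ 2 - t) / 2 := by linarith
    rw [h1, h2]
    ring
  have hb0 : 0 < b := by nlinarith
  -- It suffices that t^2 - 1 ≤ r ≤ 2(t^2 - 1); the upper estimate uses t ≥ 2.
  have har : |(t ^ 2 - 1) - r| ≤ (t ^ 2 - 1 + r) / 2 := by
    have h1 : t ^ 2 - 1 ≤ r := by
      refine le_of_sq_le_sq ?_ hr0.le
      rw [hr2]
      nlinarith
    have h2 : r ≤ 2 * (t ^ 2 - 1) := by
      refine le_of_sq_le_sq ?_ (by linarith)
      rw [hr2]
      nlinarith
    rw [abs_le]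
    constructor <;> linarith
  obtain ⟨K, hK⟩ := exists_add_partialCodimension_ne_zero F hq
  have hE := fun g h : PauliGroup q =>
    (pauliBasis_mul (F := F) g h).imp fun _ hc => hc.1
  -- This is w = √(c/b), for which bw and c/w both equal r/2.
  have hw : 0 < r / (2 * b) := by positivity
  have hcodim := sum_multinomial_balancedTypes_le_mul_gradedCodimension hK
  generalize (Finset.piAntidiag (Finset.univ : Finset (PauliGroup q)) K).card = M at hcodim
  -- `M + 1` in place of `M` keeps C visibly positive; D = 1 + w + w⁻¹ satisfies D w^k ≥ 1 for k =
  -- -1, 0, 1.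
  refine tendsto_rpow_one_div_of_growth (K := K) (C := 4 * (M + 1))
    (D := 1 + r / (2 * b) + (r / (2 * b))⁻¹)
    (by positivity) (by positivity) (by positivity) ?_ ?_
  · intro N hN
    have h1 := pow_le_sum_multinomial_balancedTypes
      ((Finset.univ : Finset (PauliGroup q)).erase 0) pauliWeight pauliWeight_cases
      (a := (2 ^ q) ^ 2 - 1) (b := (symmDegrees q).card) (c := (skewDegrees q).card)
      (by simp [card_filter_pauliWeight]) (by simp [card_filter_pauliWeight])
      (by simp [card_filter_pauliWeight]) hbc (by rw [hA]; exact har) hN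
    rw [hA] at h1
    have h2 : ((∑ n ∈ balancedTypes ((Finset.univ : Finset (PauliGroup q)).erase 0)
        pauliWeight N, Nat.multinomial Finset.univ n : ℕ) : ℝ) ≤
        (M + 1) * gradedCodimension F (pauliGrading F q) (N + K) := by
      have h3 := (hcodim N).trans
        (Nat.mul_le_mul_right _ (Nat.le_succ _))
      exact_mod_cast h3
    calc _ ≤ _ := h1
      _ ≤ _ := mul_le_mul_of_nonneg_left h2 (by positivity)
      _ = _ := by ring
  · intro N
    have h1 := gradedCodimension_le_pow (s := Finset.univ.erase 0) (z := pauliWeight)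
      (pauliGrading_eq_span (F := F) (q := q)) hE
      (fun g hg => by
        obtain rfl : g = 0 := by simpa using hg
        exact pauliBasis_zero F)
      (fun g h hgh => by
        obtain ⟨c, hc, hcw⟩ := pauliBasis_mul (F := F) g h
        refine hcw fun h0 => hgh ?_
        rw [hc, h0, zero_smul])
      hw (D := 1 + r / (2 * b) + (r / (2 * b))⁻¹)
      (fun g => by
        have hwi := inv_pos.mpr hw
        have hm := mul_inv_cancel₀ hw.ne'
        rcases pauliWeight_cases g with h | h | h <;> rw [h]
        · rw [_root_.zpow_neg_one]
          nlinarith [mul_pos hwi hwi]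
        · rw [zpow_zero]
          linarith
        · rw [zpow_one]
          nlinarith [mul_pos hw hw])
      (by positivity) N
    rw [sum_erase_zero_pauliGroup (fun k => (r / (2 * b)) ^ k), zpow_zero, zpow_one, _root_.zpow_neg_one,
      nsmul_eq_mul, nsmul_eq_mul, nsmul_eq_mul, hA, ← hb, ← hc] at h1
    have h2 : (t ^ 2 - 1) * 1 + (b * (r / (2 * b)) + c * (r / (2 * b))⁻¹) = t ^ 2 - 1 + r := by
      rw [inv_div]
      have h3 : b * (r / (2 * b)) = r / 2 := by field_simp
      have h4 : c * (2 * b / r) = r / 2 := by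
        field_simp
        linarith
      rw [h3, h4]
      ring
    rwa [h2] at h1
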